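/- **Setting.** Let $n\ge 2$ and let $r:\mathbb C^n\to\mathbb R$ be smooth and convex, such that $\Omega=\{r<0\}$ is non-empty, bounded and of finite type $M$ (the supremum over $p\in b\Omega$ of the maximal order of contact of $\{r=0\}$ at $p$ with germs of non-singular complex analytic sets is $M<\infty$), and $|\nabla r|=1$ on $b\Omega$. *Quasi-metric.* For $\xi,u\in\mathbb C^n$ and $\varepsilon>0$ let $\tau(\xi,u,\varepsilon)=\sup\{c>0: |r(\xi+\lambda u)-r(\xi)|\le\varepsilon \text{ for all } \lambda\in\mathbb C,\ |\lambda|\le c\}$. An $\varepsilon$-extremal basis at $\xi\in b\Omega$ is a (complex) orthonormal basis $u_1,\dots,u_n$ of $\mathbb C^n$ such that $u_1$ is the direction of $q_1-\xi$, where $q_1=\xi+s\nabla r(\xi)$, $s>0$, $r(q_1)=r(\xi)+\varepsilon$, and such that for $k\ge2$ the vector $u_k$ maximizes, among the unit vectors $u$ orthogonal to $u_1,\dots,u_{k-1}$, the distance from $\xi$ to $\{r=r(\xi)+\varepsilon\}$ along the complex line $\xi+\mathbb C u$. Fix a choice of such a basis for all $\xi\in b\Omega$, $\varepsilon>0$,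 and let $P_\varepsilon(\xi)=\{\xi+\sum_k\lambda_ku_k: |\lambda_k|\le\tau(\xi,u_k,\varepsilon)\}$, $\rho(\zeta_1,\zeta_2)=\inf\{\varepsilon>0:\zeta_1\in P_\varepsilon(\zeta_2),\ \zeta_2\in P_\varepsilon(\zeta_1)\}$ and $B(\zeta,\varepsilon)=\{\eta\in b\Omega:\rho(\eta,\zeta)<\varepsilon\}$. Let $\sigma$ be the surface measure on $b\Omega$. *Dyadic decompositions.* A dyadic decomposition of $b\Omega$ consists of constants $\mathfrak C>0$, $0<\delta,\epsilon<1$ and families $\mathcal D_k$, $k\ge1$, of Borel subsets of $b\Omega$ (cubes; those in $\mathcal D_k$ have sidelength $\ell(Q)=\delta^k$), with centers $c(Q)\in b\Omega$, such that: (1) $b\Omega=\bigcup_{Q\in\mathcal D_k}Q$ for every $k\ge 1$; (2) of any two cubes that intersect, one contains the other; (3) every $Q\in\mathcal D_k$ contains some $Q'\in\mathcal D_{k+1}$; (4) every $Q\in\mathcal D_{k+1}$ is contained in exactly one element of $\mathcal D_k$; (5) if $Q_1\in\mathcal D_k$, $Q_2\in\mathcal D_{k+1}$, $Q_2\subseteq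 Q_1$, then $\sigma(Q_2)\ge\epsilon\,\sigma(Q_1)$; (6) $B(c(Q),\delta^k)\subseteq Q\subseteq B(c(Q),\mathfrak C\delta^k)$ for $Q\in\mathcal D_k$. *Flow tents.* Let $V\subseteq U$ be open neighborhoods of $b\Omega$ and $t_0>0$ such that $\frac23\le|\nabla r|\le\frac32$ on $U$ and the flow of $-\nabla r/|\nabla r|^2$ from each point of $V$ exists in $U$ for the times in $[0,t_0)$. Let $\Pi^{flow}(z)$ be the point of $b\Omega$ that flows, within $U$, into $z$ at time $-r(z)$. For a dyadic decomposition choose $N_0\ge1$ with $\delta^{N_0}<t_0$ and $\{-\delta^{N_0}<r<0\}\subseteq V$, and let $\mathcal D$ be the collection that consists of $\Omega$ and of the dyadic flow tents $$T^{flow}_d(Q)=\{z\in V:\ \Pi^{flow}(z)\in Q,\ -\delta^k<r(z)<0\},\qquad Q\in\mathcal D_k,\ k\ge N_0 .$$ *Muckenhoupt bases.* A basis $\mathcal B$ of $\Omega$ is a collection of measurable subsets of $\Omega$ of positive volume. Write $\langle f\rangle_B=\frac1{\mathrm{Vol}(B)}\int_B|f|\,dV$ and $M_{\mathcal B}f(z)=\sup_{z\in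 B\in\mathcal B}\langle f\rangle_B$. For $1<p<\infty$, $\frac1p+\frac1{p'}=1$, a measurable $w:\Omega\to[0,\infty)$ belongs to $A_{p,\mathcal B}$ if $[w]_{A_{p,\mathcal B}}=\sup_{B\in\mathcal B}\langle w\rangle_B\langle w^{1-p'}\rangle_B^{p-1}<\infty$ (with values in $[0,\infty]$, $0^{1-p'}=\infty$ and $0\cdot\infty=0$). $\mathcal B$ is a Muckenhoupt basis if for all $1<p<\infty$, $K<\infty$, every $w\in A_{p,\mathcal B}$ with $[w]_{A_{p,\mathcal B}}\le K$ and every measurable $f:\Omega\to\mathbb C$, the function $M_{\mathcal B}f$ is measurable and $$\int_\Omega (M_{\mathcal B}f)^p\,w\,dV\le C(p,K)\int_\Omega|f|^p\,w\,dV .$$ **Proposition.** (a) Each collection $\mathcal D$ as above is a Muckenhoupt basis of $\Omega$, with constants $C(p,K)$ that depend only on $p$, $K$, $r$ and $n$. (b) For every $K_0$ and all such collections $\mathcal D^1,\dots,\mathcal D^{K_0}$ (with the same $U,V,t_0$ and the same extremal bases), $\mathcal G=\bigcup_{i=1}^{K_0}\mathcal D^i$ is a Muckenhoupt basis of $\Omega$,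 with constants $C(p,K)$ that depend only on $p$, $K$, $r$, $n$ and $K_0$. -/

import Mathlib

open MeasureTheory Set
open scoped ENNReal NNReal ContDiff

noncomputable section

namespace FlowTents

/-- `ℂⁿ` with its Euclidean norm; its `volume` is Lebesgue measure on `ℝ²ⁿ`. -/
abbrev Cn (n : ℕ) : Type := EuclideanSpace ℂ (Fin n)

variable {n : ℕ}

/-! ### The domain -/

/-- The domain `Ω = {r < 0}`. -/
def domain (r : Cn n → ℝ) : Set (Cn n) := {z | r z < 0}

/-- The boundary `bΩ`. -/
def bdry (r : Cn n → ℝ) : Set (Cn n) := frontier (domain r)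

/-- The orders of contact at `p` of `{r = 0}` with germs of non-singular holomorphic curves.
(A non-singular analytic germ of higher dimension contains non-singular curves, whose order of
contact is at least as large, so that curves give the same supremum.) -/
def contactOrders (r : Cn n → ℝ) (p : Cn n) : Set ℕ :=
  {m | ∃ γ : ℂ → Cn n, AnalyticAt ℂ γ 0 ∧ γ 0 = p ∧ deriv γ 0 ≠ 0 ∧
    (fun ζ : ℂ => r (γ ζ)) =O[nhds 0] (fun ζ : ℂ => ‖ζ‖ ^ m)}

/-- The type of the boundary point `p`. -/
def pointType (r : Cn n → ℝ) (p : Cn n) : ℕ∞ := ⨆ m ∈ contactOrders r p, (m : ℕ∞)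

/-- `r` is a smooth, everywhere convex defining function, normalized by `|∇r| = 1` on `bΩ`, of a
bounded (non-empty, convex) domain of finite type `M`. -/
structure IsDefiningFunction (r : Cn n → ℝ) (M : ℕ) : Prop where
  smooth : ContDiff ℝ ∞ r
  convex : ConvexOn ℝ univ r
  nonempty : (domain r).Nonempty
  bounded : Bornology.IsBounded (domain r)
  norm_gradient : ∀ z ∈ bdry r, ‖gradient r z‖ = 1
  type_eq : ⨆ p ∈ bdry r, pointType r p = (M : ℕ∞)

/-! ### McNeal-Stein tents and the quasi-metric on the boundary -/

/-- `τ(ξ, u, ε)`, the supremum of the `c` with `|r (ξ + λ u) - r ξ| ≤ ε` for all complex `λ`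
with `|λ| ≤ c`. -/
def tau (r : Cn n → ℝ) (ξ u : Cn n) (ε : ℝ) : ℝ≥0∞ :=
  ⨆ c ∈ {c : ℝ≥0 | ∀ l : ℂ, ‖l‖ ≤ c → |r (ξ + l • u) - r ξ| ≤ ε}, (c : ℝ≥0∞)

/-- The distance from `ξ` to the level set `{r = r ξ + ε}` along the complex line `ξ + ℂ u`. -/
def levelDist (r : Cn n → ℝ) (ξ u : Cn n) (ε : ℝ) : ℝ :=
  Metric.infDist ξ {z | r z = r ξ + ε ∧ ∃ l : ℂ, z = ξ + l • u}

/-- `b` is an `ε`-extremal basis at `ξ`: its first vector is the direction in which the line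
through `ξ` along the gradient reaches `{r = r ξ + ε}`, and each further vector maximizes the
distance to this level set among the unit vectors orthogonal (over `ℂ`) to the preceding ones. -/
def IsExtremalBasis (r : Cn n → ℝ) (ξ : Cn n) (ε : ℝ)
    (b : OrthonormalBasis (Fin n) ℂ (Cn n)) : Prop :=
  (∀ i : Fin n, i.val = 0 → ∃ s : ℝ, 0 < s ∧ r (ξ + s • gradient r ξ) = r ξ + ε ∧
    b i = ‖s • gradient r ξ‖⁻¹ • (s • gradient r ξ)) ∧
  (∀ i : Fin n, 0 < i.val → ∀ v : Cn n, ‖v‖ = 1 → (∀ j < i, inner ℂ (b j) v = 0) →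
    levelDist r ξ v ε ≤ levelDist r ξ (b i) ε)

/-- A choice of bases, one for each point and each scale. -/
abbrev BasisChoice (n : ℕ) : Type := Cn n → ℝ → OrthonormalBasis (Fin n) ℂ (Cn n)

/-- The chosen basis is extremal at every boundary point and every scale. -/
def IsExtremalChoice (r : Cn n → ℝ) (e : BasisChoice n) : Prop :=
  ∀ ξ ∈ bdry r, ∀ ε : ℝ, 0 < ε → IsExtremalBasis r ξ ε (e ξ ε)

/-- The polydisc `P_ε(ξ)`. -/
def polydisc (r : Cn n → ℝ) (e : BasisChoice n) (ξ : Cn n) (ε : ℝ) : Set (Cn n) :=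
  {z | ∀ k, ‖(e ξ ε).repr (z - ξ) k‖ₑ ≤ tau r ξ (e ξ ε k) ε}

/-- The quasi-metric `ρ` on `bΩ`. -/
def rho (r : Cn n → ℝ) (e : BasisChoice n) (ζ₁ ζ₂ : Cn n) : ℝ :=
  sInf {ε : ℝ | 0 < ε ∧ ζ₁ ∈ polydisc r e ζ₂ ε ∧ ζ₂ ∈ polydisc r e ζ₁ ε}

/-- The ball `B(ζ, ε)` in `bΩ`. -/
def qball (r : Cn n → ℝ) (e : BasisChoice n) (ζ : Cn n) (ε : ℝ) : Set (Cn n) :=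
  {η | η ∈ bdry r ∧ rho r e η ζ < ε}

/-- The surface measure `σ`, i.e. the Euclidean `(2n-1)`-dimensional measure, used on subsets of
`bΩ`. -/
def surf (n : ℕ) : Measure (Cn n) := Measure.euclideanHausdorffMeasure (2 * n - 1)

/-! ### Dyadic decompositions of the boundary -/

/-- A dyadic decomposition of `bΩ`: generations `cubes k`, `k ≥ 1`, of Borel sets with centers
`center k Q` and sidelength `δ ^ k`. -/
structure DyadicGrid (r : Cn n → ℝ) (e : BasisChoice n) where
  cubes : ℕ → Set (Set (Cn n))
  center : ℕ → Set (Cn n) → Cn n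
  bigC : ℝ
  δ : ℝ
  ϵ : ℝ
  bigC_pos : 0 < bigC
  δ_pos : 0 < δ
  δ_lt_one : δ < 1
  ϵ_pos : 0 < ϵ
  ϵ_lt_one : ϵ < 1
  measurable : ∀ k, 1 ≤ k → ∀ Q ∈ cubes k, MeasurableSet Q
  cover : ∀ k, 1 ≤ k → ⋃₀ cubes k = bdry r
  nested : ∀ k l, 1 ≤ k → 1 ≤ l → ∀ Q₁ ∈ cubes k, ∀ Q₂ ∈ cubes l,
    (Q₁ ∩ Q₂).Nonempty → Q₁ ⊆ Q₂ ∨ Q₂ ⊆ Q₁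
  exists_child : ∀ k, 1 ≤ k → ∀ Q ∈ cubes k, ∃ Q' ∈ cubes (k + 1), Q' ⊆ Q
  exists_unique_parent : ∀ k, 1 ≤ k → ∀ Q ∈ cubes (k + 1), ∃! P, P ∈ cubes k ∧ Q ⊆ P
  child_measure : ∀ k, 1 ≤ k → ∀ Q₁ ∈ cubes k, ∀ Q₂ ∈ cubes (k + 1), Q₂ ⊆ Q₁ →
    ENNReal.ofReal ϵ * surf n Q₁ ≤ surf n Q₂
  center_mem : ∀ k, 1 ≤ k → ∀ Q ∈ cubes k, center k Q ∈ bdry r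
  sandwich : ∀ k, 1 ≤ k → ∀ Q ∈ cubes k,
    qball r e (center k Q) (δ ^ k) ⊆ Q ∧ Q ⊆ qball r e (center k Q) (bigC * δ ^ k)

/-! ### The normal gradient flow and the dyadic flow tents -/

/-- The vector field `-∇r / |∇r|²`. -/
def normalField (r : Cn n → ℝ) (z : Cn n) : Cn n := -((‖gradient r z‖ ^ 2)⁻¹ • gradient r z)

/-- `γ` is an integral curve in `U`, on the time set `I`, of `-∇r / |∇r|²`, starting at `x`. -/
def IsFlowLine (r : Cn n → ℝ) (U : Set (Cn n)) (I : Set ℝ) (x : Cn n) (γ : ℝ → Cn n) : Prop :=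
  γ 0 = x ∧ ∀ t ∈ I, γ t ∈ U ∧ HasDerivWithinAt γ (normalField r (γ t)) I t

/-- `U` is a neighborhood of `bΩ` with `2/3 ≤ |∇r| ≤ 3/2`, and `V ⊆ U` is a neighborhood of `bΩ`
such that the flow starting at points of `V` exists in `U` for all times in `[0, t₀)`. -/
structure IsFlowNeighborhood (r : Cn n → ℝ) (U V : Set (Cn n)) (t₀ : ℝ) : Prop where
  isOpen_U : IsOpen U
  isOpen_V : IsOpen V
  bdry_subset : bdry r ⊆ V
  subset : V ⊆ U
  gradient_bounds : ∀ z ∈ U, 2 / 3 ≤ ‖gradient r z‖ ∧ ‖gradient r z‖ ≤ 3 / 2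
  t₀_pos : 0 < t₀
  flow : ∀ x ∈ V, ∃ γ : ℝ → Cn n, IsFlowLine r U (Ico 0 t₀) x γ

/-- `x ∈ bΩ` flows into `z` at the time `-r z`. -/
def FlowsTo (r : Cn n → ℝ) (U : Set (Cn n)) (x z : Cn n) : Prop :=
  x ∈ bdry r ∧ ∃ γ : ℝ → Cn n, IsFlowLine r U (Icc 0 (-r z)) x γ ∧ γ (-r z) = z

open Classical in
/-- The projection `Π^flow` to the boundary along the flow lines: the (unique) boundary point that
flows into `z` at the time `-r z`. (If there is none, the value is `z`.) -/
def flowProj (r : Cn n → ℝ) (U : Set (Cn n)) (z : Cn n) : Cn n :=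
  if h : ∃ x, FlowsTo r U x z then h.choose else z

/-- The dyadic flow tent over `Q`, where `Q` has sidelength `l`. -/
def flowTent (r : Cn n → ℝ) (U V : Set (Cn n)) (Q : Set (Cn n)) (l : ℝ) : Set (Cn n) :=
  {z | z ∈ V ∧ flowProj r U z ∈ Q ∧ r z ∈ Ioo (-l) 0}

/-- `N₀` is an admissible first generation: the flow reaches all levels up to depth `δ ^ N₀`, and
the part of `Ω` above this depth lies in `V`. -/
def IsAdmissible (r : Cn n → ℝ) (V : Set (Cn n)) (t₀ δ : ℝ) (N₀ : ℕ) : Prop :=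
  1 ≤ N₀ ∧ δ ^ N₀ < t₀ ∧ domain r \ {z | r z ≤ -δ ^ N₀} ⊆ V

/-- The collection of the dyadic flow tents over the cubes of the generations `k ≥ N₀`, together
with `Ω`, the tent over `bΩ`. -/
def tents (r : Cn n → ℝ) (U V : Set (Cn n)) {e : BasisChoice n} (D : DyadicGrid r e) (N₀ : ℕ) :
    Set (Set (Cn n)) :=
  {domain r} ∪ {T | ∃ k, N₀ ≤ k ∧ ∃ Q ∈ D.cubes k, T = flowTent r U V Q (D.δ ^ k)}

/-! ### Muckenhoupt bases -/

/-- The average of a non-negative function over `B`. -/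
def avg (B : Set (Cn n)) (g : Cn n → ℝ≥0∞) : ℝ≥0∞ := (volume B)⁻¹ * ∫⁻ z in B, g z

/-- The maximal operator `M_𝓑`. (It vanishes off the union of `𝓑`.) -/
def maximalOp (𝓑 : Set (Set (Cn n))) (f : Cn n → ℂ) (z : Cn n) : ℝ≥0∞ :=
  ⨆ B ∈ {B | B ∈ 𝓑 ∧ z ∈ B}, avg B (fun y => ‖f y‖ₑ)

/-- A basis of `Ω`: a collection of measurable subsets of `Ω` of positive volume. -/
def IsBasis (Ω : Set (Cn n)) (𝓑 : Set (Set (Cn n))) : Prop :=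
  ∀ B ∈ 𝓑, MeasurableSet B ∧ B ⊆ Ω ∧ 0 < volume B

/-- The weight `w` belongs to `A_{p,𝓑}` with `[w]_{A_{p,𝓑}} ≤ K`. Powers and products are taken
in `[0, ∞]`, so that `w ^ (1 - p')` is `∞` where `w` vanishes. -/
def ApBound (𝓑 : Set (Set (Cn n))) (p : ℝ) (w : Cn n → ℝ≥0) (K : ℝ≥0) : Prop :=
  ∀ B ∈ 𝓑, avg B (fun z => (w z : ℝ≥0∞)) *
    avg B (fun z => (w z : ℝ≥0∞) ^ (1 - p.conjExponent)) ^ (p - 1) ≤ K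

/-- `𝓑` is a Muckenhoupt basis of `Ω` with bound `C p K` for the `p`-th power of the norm of `M_𝓑`
on `L^p(w)` when `[w]_{A_{p,𝓑}} ≤ K`. -/
def IsMuckenhouptBasis (Ω : Set (Cn n)) (𝓑 : Set (Set (Cn n))) (C : ℝ → ℝ≥0 → ℝ≥0) : Prop :=
  IsBasis Ω 𝓑 ∧
  ∀ p : ℝ, 1 < p → ∀ w : Cn n → ℝ≥0, AEMeasurable w (volume.restrict Ω) →
    ∀ K : ℝ≥0, ApBound 𝓑 p w K →
      ∀ f : Cn n → ℂ, AEMeasurable f (volume.restrict Ω) →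
        AEMeasurable (maximalOp 𝓑 f) (volume.restrict Ω) ∧
        ∫⁻ z in Ω, maximalOp 𝓑 f z ^ p * w z ≤ C p K * ∫⁻ z in Ω, ‖f z‖ₑ ^ p * w z

end FlowTents

end

/-! The tents of a dyadic decomposition, together with `Ω`, form a countable laminar family: two
tents that meet lie over cubes that meet. They are measurable and have positive volume because
`Π^flow` has a continuous extension to the shell `{-t₀ < r < 0}` with the boundary values of the
identity.

On a countable laminar family the superlevel sets of a maximal function are increasing limits of
disjoint unions of members, so Doob's inequality `‖M_μ f‖_p ≤ p' ‖f‖_p` holds for every finite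
measure `μ`. For an `A_p` weight `w` with dual weight `σ = w^{1-p'}`, the identities
`⟨f⟩_B = ⟨σ⟩_B ⟨f / σ⟩_{B, σ}` and `⟨h⟩_B = ⟨w⟩_B ⟨h / w⟩_{B, w}` give Lerner's pointwise bound
`(M f)^{p-1} ≤ K M_w ((M_σ (f / σ))^{p-1} / w)`. Doob's inequality for `w dV` in `L^{p'}` and for
`σ dV` in `L^p` then yields the weighted bound, with a constant that involves only `p` and `K`. -/

noncomputable section

namespace FlowTents

section MaximalFunction

variable {α : Type*}

/-- A laminar (or nested) family of sets: any two members that meet are comparable. -/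
def IsLaminar (𝓑 : Set (Set α)) : Prop :=
  ∀ A ∈ 𝓑, ∀ B ∈ 𝓑, (A ∩ B).Nonempty → A ⊆ B ∨ B ⊆ A

lemma IsLaminar.mono {𝓐 𝓑 : Set (Set α)} (h𝓑 : IsLaminar 𝓑) (h : 𝓐 ⊆ 𝓑) : IsLaminar 𝓐 :=
  fun A hA B hB => h𝓑 A (h hA) B (h hB)

lemma IsLaminar.pairwise_disjoint_maximal {𝓑 : Set (Set α)} (h𝓑 : IsLaminar 𝓑) :
    {B | Maximal (· ∈ 𝓑) B}.Pairwise Disjoint := by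
  intro A hA B hB hAB
  rw [← not_not (a := Disjoint A B), not_disjoint_iff_nonempty_inter]
  intro hne
  rcases h𝓑 A hA.prop B hB.prop hne with h | h
  · exact hAB (hA.eq_of_subset hB.prop h)
  · exact hAB (hB.eq_of_subset hA.prop h).symm

lemma sUnion_maximal {𝓑 : Set (Set α)} (hfin : 𝓑.Finite) :
    ⋃₀ {B | Maximal (· ∈ 𝓑) B} = ⋃₀ 𝓑 := by
  refine (sUnion_mono fun B hB => hB.prop).antisymm (sUnion_subset fun A hA => ?_)
  obtain ⟨B, hAB, hB⟩ := hfin.exists_le_maximal hA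
  exact hAB.trans (subset_sUnion_of_mem hB)

variable [MeasurableSpace α] {μ ν : Measure α} {𝓑 : Set (Set α)}

lemma IsLaminar.mul_measure_sUnion_le_of_finite (h𝓑 : IsLaminar 𝓑) (hfin : 𝓑.Finite)
    (hm : ∀ B ∈ 𝓑, MeasurableSet B) {c : ℝ≥0∞} (hle : ∀ B ∈ 𝓑, c * μ B ≤ ν B) :
    c * μ (⋃₀ 𝓑) ≤ ν (⋃₀ 𝓑) := by
  have hcount : {B | Maximal (· ∈ 𝓑) B}.Countable := (hfin.subset fun B hB => hB.prop).countable
  rw [← sUnion_maximal hfin,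
    measure_sUnion hcount h𝓑.pairwise_disjoint_maximal fun B hB => hm B hB.prop,
    measure_sUnion hcount h𝓑.pairwise_disjoint_maximal fun B hB => hm B hB.prop,
    ← ENNReal.tsum_mul_left]
  exact ENNReal.tsum_le_tsum fun B => hle B B.2.prop

lemma IsLaminar.mul_measure_sUnion_le (h𝓑 : IsLaminar 𝓑) (hcount : 𝓑.Countable)
    (hm : ∀ B ∈ 𝓑, MeasurableSet B) {c : ℝ≥0∞} (hle : ∀ B ∈ 𝓑, c * μ B ≤ ν B) :
    c * μ (⋃₀ 𝓑) ≤ ν (⋃₀ 𝓑) := by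
  have hUnion : ⋃₀ 𝓑 = ⋃ s ∈ {s : Set (Set α) | s.Finite ∧ s ⊆ 𝓑}, ⋃₀ s :=
    (iUnion₂_subset fun s hs => sUnion_mono hs.2).antisymm' <| sUnion_subset fun B hB =>
      subset_iUnion₂_of_subset {B} ⟨finite_singleton B, singleton_subset_iff.2 hB⟩
        (sUnion_singleton B).ge
  have hdir : DirectedOn (fun s t : Set (Set α) => ⋃₀ s ⊆ ⋃₀ t) {s | s.Finite ∧ s ⊆ 𝓑} :=
    fun s hs t ht => ⟨s ∪ t, ⟨hs.1.union ht.1, union_subset hs.2 ht.2⟩,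
      sUnion_mono subset_union_left, sUnion_mono subset_union_right⟩
  rw [hUnion, measure_biUnion_eq_iSup (countable_ofPred_finite_subset hcount) hdir]
  simp_rw [ENNReal.mul_iSup]
  refine iSup₂_le fun s hs => ?_
  exact ((h𝓑.mono hs.2).mul_measure_sUnion_le_of_finite hs.1 (fun B hB => hm B (hs.2 hB))
    fun B hB => hle B (hs.2 hB)).trans (measure_mono (subset_iUnion₂ (s := fun s _ => ⋃₀ s) s hs))

/-- The maximal function of `f` over the members of the family `𝓑`, for the measure `μ`. -/
def maximalFunction (μ : Measure α) (𝓑 : Set (Set α)) (f : α → ℝ≥0∞) (x : α) : ℝ≥0∞ :=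
  ⨆ B ∈ {B | B ∈ 𝓑 ∧ x ∈ B}, ⨍⁻ y in B, f y ∂μ

lemma setLAverage_le_maximalFunction {B : Set α} (hB : B ∈ 𝓑) {x : α} (hx : x ∈ B)
    (f : α → ℝ≥0∞) : ⨍⁻ y in B, f y ∂μ ≤ maximalFunction μ 𝓑 f x :=
  le_iSup₂_of_le B ⟨hB, hx⟩ le_rfl

lemma setOf_lt_maximalFunction (f : α → ℝ≥0∞) (c : ℝ≥0∞) :
    {x | c < maximalFunction μ 𝓑 f x} = ⋃₀ {B ∈ 𝓑 | c < ⨍⁻ y in B, f y ∂μ} := by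
  ext x
  simp only [maximalFunction, mem_ofPred_eq, lt_iSup_iff, mem_sUnion, exists_prop]
  exact exists_congr fun B => by tauto

lemma measurable_maximalFunction (hcount : 𝓑.Countable) (hm : ∀ B ∈ 𝓑, MeasurableSet B)
    (f : α → ℝ≥0∞) : Measurable (maximalFunction μ 𝓑 f) := by
  refine measurable_of_Ioi fun c => ?_
  change MeasurableSet {x | c < maximalFunction μ 𝓑 f x}
  rw [setOf_lt_maximalFunction]
  exact .sUnion (hcount.mono (sep_subset _ _)) fun B hB => hm B hB.1

lemma IsLaminar.mul_measure_lt_maximalFunction_le (h𝓑 : IsLaminar 𝓑) (hcount : 𝓑.Countable)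
    (hm : ∀ B ∈ 𝓑, MeasurableSet B) (f : α → ℝ≥0∞) (c : ℝ≥0∞) :
    c * μ {x | c < maximalFunction μ 𝓑 f x} ≤
      μ.withDensity f {x | c < maximalFunction μ 𝓑 f x} := by
  rw [setOf_lt_maximalFunction]
  refine (h𝓑.mono (sep_subset _ _)).mul_measure_sUnion_le (hcount.mono (sep_subset _ _))
    (fun B hB => hm B hB.1) fun B ⟨hB, hcB⟩ => ?_
  rw [withDensity_apply _ (hm B hB)]
  rw [setLAverage_eq] at hcB
  exact ENNReal.mul_le_of_le_div hcB.le

lemma lintegral_rpow_eq_lintegral_lt_mul {g : α → ℝ≥0} (hg : Measurable g) {p : ℝ} (hp : 0 < p) :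
    ∫⁻ x, (g x : ℝ≥0∞) ^ p ∂μ = ENNReal.ofReal p *
      ∫⁻ t in Ioi (0 : ℝ), μ {x | ENNReal.ofReal t < g x} * ENNReal.ofReal (t ^ (p - 1)) := by
  convert lintegral_rpow_eq_lintegral_meas_lt_mul (f := fun x => (g x : ℝ)) μ
    (.of_forall fun x => (g x).coe_nonneg) hg.coe_nnreal_real.aemeasurable hp using 1
  · refine lintegral_congr fun x => ?_
    rw [← ENNReal.ofReal_rpow_of_nonneg (g x).coe_nonneg hp.le, ENNReal.ofReal_coe_nnreal]
  · congr 1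
    refine setLIntegral_congr_fun measurableSet_Ioi fun t ht => ?_
    simp only [← ENNReal.ofReal_coe_nnreal, ENNReal.ofReal_lt_ofReal_iff_of_nonneg ht.le]

lemma lintegral_rpow_le_lintegral_mul_rpow {p q : ℝ} (hpq : p.HolderConjugate q)
    {f : α → ℝ≥0∞} (hf : AEMeasurable f μ) {g : α → ℝ≥0} (hg : Measurable g)
    (hfg : ∀ c : ℝ≥0∞, c * μ {x | c < g x} ≤ μ.withDensity f {x | c < g x}) :
    ∫⁻ x, (g x : ℝ≥0∞) ^ p ∂μ ≤ ENNReal.ofReal q * ∫⁻ x, f x * (g x : ℝ≥0∞) ^ (p - 1) ∂μ := by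
  have hlevel : ∀ t ∈ Ioi (0 : ℝ),
      μ {x | ENNReal.ofReal t < g x} * ENNReal.ofReal (t ^ (p - 1)) ≤
        μ.withDensity f {x | ENNReal.ofReal t < g x} * ENNReal.ofReal (t ^ (p - 1 - 1)) := by
    intro t ht
    calc _ = ENNReal.ofReal t * μ {x | ENNReal.ofReal t < g x} *
            ENNReal.ofReal (t ^ (p - 1 - 1)) := by
          rw [mul_comm (ENNReal.ofReal t), mul_assoc, ← ENNReal.ofReal_mul ht.le,
            ← Real.rpow_one_add' ht.le (by linarith [hpq.lt]), add_sub_cancel]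
      _ ≤ _ := by gcongr; exact hfg _
  calc ∫⁻ x, (g x : ℝ≥0∞) ^ p ∂μ
      ≤ ENNReal.ofReal p * ∫⁻ t in Ioi (0 : ℝ),
          μ.withDensity f {x | ENNReal.ofReal t < g x} * ENNReal.ofReal (t ^ (p - 1 - 1)) := by
        rw [lintegral_rpow_eq_lintegral_lt_mul hg hpq.pos]
        gcongr 1
        exact setLIntegral_mono' measurableSet_Ioi hlevel
    _ = ENNReal.ofReal q * (ENNReal.ofReal (p - 1) * ∫⁻ t in Ioi (0 : ℝ),
          μ.withDensity f {x | ENNReal.ofReal t < g x} * ENNReal.ofReal (t ^ (p - 1 - 1))) := by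
        rw [← mul_assoc, ← ENNReal.ofReal_mul hpq.symm.nonneg, mul_comm q, hpq.sub_one_mul_conj]
    _ = ENNReal.ofReal q * ∫⁻ x, f x * (g x : ℝ≥0∞) ^ (p - 1) ∂μ := by
        rw [← lintegral_rpow_eq_lintegral_lt_mul hg hpq.sub_one_pos,
          lintegral_withDensity_eq_lintegral_mul₀ hf
            (hg.coe_nnreal_ennreal.pow_const _).aemeasurable]
        rfl

lemma le_rpow_of_le_mul_rpow {p q : ℝ} (hpq : p.HolderConjugate q) {a I : ℝ≥0∞} (hI : I ≠ ⊤)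
    (h : I ≤ a * I ^ (1 / q)) : I ≤ a ^ p := by
  rcases eq_or_ne I 0 with rfl | h0
  · exact zero_le
  have hsplit : I ^ (1 / p) * I ^ (1 / q) = I := by
    rw [← ENNReal.rpow_add _ _ h0 hI, hpq.one_div_add_one_div, one_div_one, ENNReal.rpow_one]
  rw [← ENNReal.rpow_inv_le_iff hpq.pos, ← one_div]
  refine (ENNReal.mul_le_mul_iff_left (c := I ^ (1 / q)) ?_ ?_).1 (hsplit.trans_le h)
  · exact (ENNReal.rpow_pos (pos_iff_ne_zero.2 h0) hI).ne'
  · exact ENNReal.rpow_ne_top_of_nonneg hpq.symm.one_div_nonneg hI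

lemma lintegral_rpow_le_of_mul_measure_lt_le_of_bounded [IsFiniteMeasure μ] {p q : ℝ}
    (hpq : p.HolderConjugate q) {f : α → ℝ≥0∞} (hf : AEMeasurable f μ) {g : α → ℝ≥0}
    (hg : Measurable g) {R : ℝ≥0} (hR : ∀ x, g x ≤ R)
    (hfg : ∀ c : ℝ≥0∞, c * μ {x | c < g x} ≤ μ.withDensity f {x | c < g x}) :
    ∫⁻ x, (g x : ℝ≥0∞) ^ p ∂μ ≤ ENNReal.ofReal q ^ p * ∫⁻ x, f x ^ p ∂μ := by
  have hfin : ∫⁻ x, (g x : ℝ≥0∞) ^ p ∂μ ≠ ⊤ := by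
    refine (IsFiniteMeasure.lintegral_lt_top_of_bounded_to_ennreal μ ⟨R ^ p, fun x => ?_⟩).ne
    rw [ENNReal.coe_rpow_of_nonneg _ hpq.nonneg]
    exact ENNReal.rpow_le_rpow (by exact_mod_cast hR x) hpq.nonneg
  refine (le_rpow_of_le_mul_rpow hpq (a := ENNReal.ofReal q * (∫⁻ x, f x ^ p ∂μ) ^ (1 / p))
    hfin ?_).trans_eq ?_
  · calc ∫⁻ x, (g x : ℝ≥0∞) ^ p ∂μ
        ≤ ENNReal.ofReal q * ∫⁻ x, f x * (g x : ℝ≥0∞) ^ (p - 1) ∂μ :=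
          lintegral_rpow_le_lintegral_mul_rpow hpq hf hg hfg
      _ ≤ ENNReal.ofReal q * ((∫⁻ x, f x ^ p ∂μ) ^ (1 / p) *
            (∫⁻ x, ((g x : ℝ≥0∞) ^ (p - 1)) ^ q ∂μ) ^ (1 / q)) := by
          gcongr
          exact ENNReal.lintegral_mul_le_Lp_mul_Lq μ hpq hf
            (hg.coe_nnreal_ennreal.pow_const _).aemeasurable
      _ = _ := by simp only [← ENNReal.rpow_mul, hpq.sub_one_mul_conj, mul_assoc]
  · rw [ENNReal.mul_rpow_of_nonneg _ _ hpq.nonneg, ← ENNReal.rpow_mul,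
      one_div_mul_cancel hpq.ne_zero, ENNReal.rpow_one]

lemma lintegral_rpow_le_of_mul_measure_lt_le [IsFiniteMeasure μ] {p q : ℝ}
    (hpq : p.HolderConjugate q) {f g : α → ℝ≥0∞} (hf : AEMeasurable f μ) (hg : Measurable g)
    (hfg : ∀ c : ℝ≥0∞, c * μ {x | c < g x} ≤ μ.withDensity f {x | c < g x}) :
    ∫⁻ x, g x ^ p ∂μ ≤ ENNReal.ofReal q ^ p * ∫⁻ x, f x ^ p ∂μ := by
  -- Truncating `g` makes the left-hand side finite, which is needed to divide by a power of it.
  have hsup : ∀ x, g x ^ p = ⨆ N : ℕ, min (g x) N ^ p := fun x => by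
    rw [← (ENNReal.monotone_rpow_of_nonneg hpq.nonneg).map_iSup_of_continuousAt
      ENNReal.continuous_rpow_const.continuousAt (ENNReal.zero_rpow_of_pos hpq.pos)]
    rw [← inf_iSup_eq, ENNReal.iSup_natCast, inf_top_eq]
  simp_rw [hsup]
  rw [lintegral_iSup (fun N => (hg.min measurable_const).pow_const p)
    (fun N M hNM x => ENNReal.rpow_le_rpow (by gcongr) hpq.nonneg)]
  refine iSup_le fun N => ?_
  have hcoe : ∀ x, ((min (g x) N).toNNReal : ℝ≥0∞) = min (g x) N := fun x =>
    ENNReal.coe_toNNReal (ne_top_of_le_ne_top (ENNReal.natCast_ne_top N) (min_le_right _ _))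
  simp_rw +singlePass [← hcoe]
  refine lintegral_rpow_le_of_mul_measure_lt_le_of_bounded hpq hf
    (hg.min measurable_const).ennreal_toNNReal (R := N) (fun x => ?_) fun c => ?_
  · exact_mod_cast (hcoe x).trans_le (min_le_right _ _)
  · simp only [hcoe, lt_min_iff]
    by_cases hc : c < N
    · simpa only [hc, and_true] using hfg c
    · simp [hc]

theorem IsLaminar.lintegral_maximalFunction_rpow_le [IsFiniteMeasure μ] (h𝓑 : IsLaminar 𝓑)
    (hcount : 𝓑.Countable) (hm : ∀ B ∈ 𝓑, MeasurableSet B) {p q : ℝ}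
    (hpq : p.HolderConjugate q) {f : α → ℝ≥0∞} (hf : AEMeasurable f μ) :
    ∫⁻ x, maximalFunction μ 𝓑 f x ^ p ∂μ ≤ ENNReal.ofReal q ^ p * ∫⁻ x, f x ^ p ∂μ :=
  lintegral_rpow_le_of_mul_measure_lt_le hpq hf (measurable_maximalFunction hcount hm f)
    (h𝓑.mul_measure_lt_maximalFunction_le hcount hm f)

end MaximalFunction

section Weights

variable {α : Type*} [MeasurableSpace α] {μ : Measure α}

/-- A weight: an integrable function that is positive almost everywhere, so that
`μ.withDensity w` is a finite measure equivalent to `μ`. -/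
structure IsWeight (μ : Measure α) (w : α → ℝ≥0∞) : Prop where
  aemeasurable : AEMeasurable w μ
  ae_ne_zero : ∀ᵐ x ∂μ, w x ≠ 0
  lintegral_ne_top : ∫⁻ x, w x ∂μ ≠ ⊤

namespace IsWeight

variable {w : α → ℝ≥0∞}

lemma ae_ne_top (hw : IsWeight μ w) : ∀ᵐ x ∂μ, w x ≠ ⊤ :=
  (ae_lt_top' hw.aemeasurable hw.lintegral_ne_top).mono fun _ => LT.lt.ne

lemma isFiniteMeasure (hw : IsWeight μ w) : IsFiniteMeasure (μ.withDensity w) :=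
  isFiniteMeasure_withDensity hw.lintegral_ne_top

lemma setLIntegral_mul_inv (hw : IsWeight μ w) {f : α → ℝ≥0∞} (hf : AEMeasurable f μ) {B : Set α}
    (hB : MeasurableSet B) :
    ∫⁻ x in B, f x * (w x)⁻¹ ∂μ.withDensity w = ∫⁻ x in B, f x ∂μ := by
  rw [setLIntegral_withDensity_eq_lintegral_mul₀ hw.aemeasurable
    (g := fun x => f x * (w x)⁻¹) (hf.mul hw.aemeasurable.inv) hB]
  refine lintegral_congr_ae <| ae_restrict_of_ae ?_
  filter_upwards [hw.ae_ne_zero, hw.ae_ne_top] with x h0 htop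
  rw [Pi.mul_apply, mul_left_comm, ENNReal.mul_inv_cancel h0 htop, mul_one]

lemma setLAverage_mul (hw : IsWeight μ w) {f : α → ℝ≥0∞} (hf : AEMeasurable f μ) {B : Set α}
    (hB : MeasurableSet B) :
    (⨍⁻ x in B, w x ∂μ) * ⨍⁻ x in B, f x * (w x)⁻¹ ∂μ.withDensity w = ⨍⁻ x in B, f x ∂μ := by
  have := hw.isFiniteMeasure
  rw [setLAverage_eq, ← withDensity_apply _ hB, ENNReal.mul_div_right_comm.symm,
    measure_mul_setLAverage _ (measure_ne_top _ _), hw.setLIntegral_mul_inv hf hB, setLAverage_eq]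

lemma lintegral_mul_inv_rpow (hw : IsWeight μ w) {f : α → ℝ≥0∞} (hf : AEMeasurable f μ) {s : ℝ}
    (hs : 0 ≤ s) :
    ∫⁻ x, (f x * (w x)⁻¹) ^ s ∂μ.withDensity w = ∫⁻ x, f x ^ s * w x ^ (1 - s) ∂μ := by
  rw [lintegral_withDensity_eq_lintegral_mul₀ hw.aemeasurable
    (g := fun x => (f x * (w x)⁻¹) ^ s) ((hf.mul hw.aemeasurable.inv).pow_const s)]
  refine lintegral_congr_ae ?_
  filter_upwards [hw.ae_ne_zero, hw.ae_ne_top] with x h0 htop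
  rw [Pi.mul_apply, ENNReal.mul_rpow_of_nonneg _ _ hs, ENNReal.inv_rpow, ← ENNReal.rpow_neg,
    mul_left_comm, sub_eq_add_neg, ENNReal.rpow_add _ _ h0 htop, ENNReal.rpow_one]

variable {p q : ℝ}

lemma lintegral_mul_inv_dual_rpow (hpq : p.HolderConjugate q)
    (hσ : IsWeight μ fun x => w x ^ (1 - q)) {f : α → ℝ≥0∞} (hf : AEMeasurable f μ) :
    ∫⁻ x, (f x * (w x ^ (1 - q))⁻¹) ^ p ∂μ.withDensity (fun x => w x ^ (1 - q)) =
      ∫⁻ x, f x ^ p * w x ∂μ := by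
  rw [hσ.lintegral_mul_inv_rpow hf hpq.nonneg]
  simp only [← ENNReal.rpow_mul]
  rw [show (1 - q) * (1 - p) = 1 by linarith [hpq.mul_eq_add]]
  simp only [ENNReal.rpow_one]

lemma lintegral_rpow_sub_one_mul_inv_rpow (hpq : p.HolderConjugate q) (hw : IsWeight μ w)
    {g : α → ℝ≥0∞} (hg : AEMeasurable g μ) :
    ∫⁻ x, (g x ^ (p - 1) * (w x)⁻¹) ^ q ∂μ.withDensity w =
      ∫⁻ x, g x ^ p ∂μ.withDensity fun x => w x ^ (1 - q) := by
  rw [hw.lintegral_mul_inv_rpow (hg.pow_const _) hpq.symm.nonneg,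
    lintegral_withDensity_eq_lintegral_mul₀ (hw.aemeasurable.pow_const _) (hg.pow_const p)]
  simp only [← ENNReal.rpow_mul, hpq.sub_one_mul_conj, Pi.mul_apply, mul_comm (w _ ^ (1 - q))]

end IsWeight

variable {𝓑 : Set (Set α)} {p q : ℝ} {w σ : α → ℝ≥0∞} {K : ℝ≥0∞}

lemma rpow_setLAverage_le [IsFiniteMeasure μ] (hp : 1 < p) (hw : IsWeight μ w)
    (hσ : IsWeight μ σ) (hcount : 𝓑.Countable) (hm : ∀ B ∈ 𝓑, MeasurableSet B) {B : Set α}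
    (hB : B ∈ 𝓑) (hA : (⨍⁻ x in B, w x ∂μ) * (⨍⁻ x in B, σ x ∂μ) ^ (p - 1) ≤ K)
    {f : α → ℝ≥0∞} (hf : AEMeasurable f μ) :
    (⨍⁻ x in B, f x ∂μ) ^ (p - 1) ≤ K * ⨍⁻ x in B,
      maximalFunction (μ.withDensity σ) 𝓑 (fun y => f y * (σ y)⁻¹) x ^ (p - 1) * (w x)⁻¹
        ∂μ.withDensity w := by
  have hp1 : 0 < p - 1 := sub_pos.2 hp
  rcases eq_or_ne (μ B) 0 with h0 | h0
  · rw [setLAverage_eq, setLIntegral_measure_zero _ _ h0, ENNReal.zero_div,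
      ENNReal.zero_rpow_of_pos hp1]
    exact zero_le
  set g := maximalFunction (μ.withDensity σ) 𝓑 fun y => f y * (σ y)⁻¹
  have hg : AEMeasurable (fun x => g x ^ (p - 1)) μ :=
    ((measurable_maximalFunction hcount hm _).pow_const _).aemeasurable
  have hle : (⨍⁻ x in B, f x * (σ x)⁻¹ ∂μ.withDensity σ) ^ (p - 1) ≤
      ⨍⁻ x in B, g x ^ (p - 1) ∂μ := by
    rw [← setLAverage_const h0 (measure_ne_top μ B)
      ((⨍⁻ x in B, f x * (σ x)⁻¹ ∂μ.withDensity σ) ^ (p - 1))]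
    refine laverage_mono_ae <| (ae_restrict_mem (hm B hB)).mono fun x hx => ?_
    exact ENNReal.rpow_le_rpow (setLAverage_le_maximalFunction hB hx _) hp1.le
  calc (⨍⁻ x in B, f x ∂μ) ^ (p - 1)
      = (⨍⁻ x in B, σ x ∂μ) ^ (p - 1) *
          (⨍⁻ x in B, f x * (σ x)⁻¹ ∂μ.withDensity σ) ^ (p - 1) := by
        rw [← hσ.setLAverage_mul hf (hm B hB), ENNReal.mul_rpow_of_nonneg _ _ hp1.le]
    _ ≤ (⨍⁻ x in B, σ x ∂μ) ^ (p - 1) * ⨍⁻ x in B, g x ^ (p - 1) ∂μ := by gcongr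
    _ = (⨍⁻ x in B, w x ∂μ) * (⨍⁻ x in B, σ x ∂μ) ^ (p - 1) *
          ⨍⁻ x in B, g x ^ (p - 1) * (w x)⁻¹ ∂μ.withDensity w := by
        rw [← hw.setLAverage_mul hg (hm B hB)]; ring
    _ ≤ _ := by gcongr

lemma maximalFunction_rpow_le [IsFiniteMeasure μ] (hpq : p.HolderConjugate q)
    (hw : IsWeight μ w) (hσ : IsWeight μ σ) (hcount : 𝓑.Countable)
    (hm : ∀ B ∈ 𝓑, MeasurableSet B)
    (hA : ∀ B ∈ 𝓑, (⨍⁻ x in B, w x ∂μ) * (⨍⁻ x in B, σ x ∂μ) ^ (p - 1) ≤ K)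
    {f : α → ℝ≥0∞} (hf : AEMeasurable f μ) (x : α) :
    maximalFunction μ 𝓑 f x ^ p ≤ K ^ q * maximalFunction (μ.withDensity w) 𝓑
      (fun y => maximalFunction (μ.withDensity σ) 𝓑 (fun z => f z * (σ z)⁻¹) y ^ (p - 1) *
        (w y)⁻¹) x ^ q := by
  rw [← ENNReal.mul_rpow_of_nonneg _ _ hpq.symm.nonneg, ← hpq.sub_one_mul_conj, ENNReal.rpow_mul,
    hpq.sub_one_mul_conj]
  refine ENNReal.rpow_le_rpow ?_ hpq.symm.nonneg
  rw [← ENNReal.le_rpow_inv_iff hpq.sub_one_pos]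
  refine iSup₂_le fun B ⟨hB, hx⟩ => ?_
  rw [ENNReal.le_rpow_inv_iff hpq.sub_one_pos]
  refine (rpow_setLAverage_le hpq.lt hw hσ hcount hm hB (hA B hB) hf).trans ?_
  gcongr
  exact setLAverage_le_maximalFunction hB hx _

lemma IsLaminar.lintegral_maximalFunction_rpow_mul_le_of_isWeight [IsFiniteMeasure μ]
    (h𝓑 : IsLaminar 𝓑) (hcount : 𝓑.Countable) (hm : ∀ B ∈ 𝓑, MeasurableSet B)
    (hpq : p.HolderConjugate q) (hw : IsWeight μ w) (hσ : IsWeight μ fun x => w x ^ (1 - q))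
    (hA : ∀ B ∈ 𝓑, (⨍⁻ x in B, w x ∂μ) * (⨍⁻ x in B, w x ^ (1 - q) ∂μ) ^ (p - 1) ≤ K)
    {f : α → ℝ≥0∞} (hf : AEMeasurable f μ) :
    ∫⁻ x, maximalFunction μ 𝓑 f x ^ p * w x ∂μ ≤
      K ^ q * (ENNReal.ofReal p ^ q * ENNReal.ofReal q ^ p) * ∫⁻ x, f x ^ p * w x ∂μ := by
  set σ : α → ℝ≥0∞ := fun x => w x ^ (1 - q)
  have := hw.isFiniteMeasure
  have := hσ.isFiniteMeasure
  set φ : α → ℝ≥0∞ := fun x => f x * (σ x)⁻¹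
  have hφ : AEMeasurable φ μ := hf.mul hσ.aemeasurable.inv
  set g := maximalFunction (μ.withDensity σ) 𝓑 φ
  have hg : Measurable g := measurable_maximalFunction hcount hm φ
  set h : α → ℝ≥0∞ := fun x => g x ^ (p - 1) * (w x)⁻¹
  have hh : AEMeasurable h μ := (hg.pow_const _).aemeasurable.mul hw.aemeasurable.inv
  have hMh : Measurable (maximalFunction (μ.withDensity w) 𝓑 h) :=
    measurable_maximalFunction hcount hm h
  calc ∫⁻ x, maximalFunction μ 𝓑 f x ^ p * w x ∂μ
      ≤ ∫⁻ x, w x * (K ^ q * maximalFunction (μ.withDensity w) 𝓑 h x ^ q) ∂μ :=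
        lintegral_mono fun x => by
          rw [mul_comm]
          gcongr
          exact maximalFunction_rpow_le hpq hw hσ hcount hm hA hf x
    _ = K ^ q * ∫⁻ x, maximalFunction (μ.withDensity w) 𝓑 h x ^ q ∂μ.withDensity w := by
        rw [← lintegral_const_mul _ (hMh.pow_const q), lintegral_withDensity_eq_lintegral_mul₀
          hw.aemeasurable ((hMh.pow_const q).const_mul _).aemeasurable]
        rfl
    _ ≤ K ^ q * (ENNReal.ofReal p ^ q * ∫⁻ x, g x ^ p ∂μ.withDensity σ) := by
        rw [← hw.lintegral_rpow_sub_one_mul_inv_rpow hpq hg.aemeasurable]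
        gcongr
        exact h𝓑.lintegral_maximalFunction_rpow_le hcount hm hpq.symm
          (hh.mono_ac (withDensity_absolutelyContinuous _ _))
    _ ≤ K ^ q * (ENNReal.ofReal p ^ q * (ENNReal.ofReal q ^ p * ∫⁻ x, f x ^ p * w x ∂μ)) := by
        rw [← IsWeight.lintegral_mul_inv_dual_rpow hpq hσ hf]
        gcongr
        exact h𝓑.lintegral_maximalFunction_rpow_le hcount hm hpq
          (hφ.mono_ac (withDensity_absolutelyContinuous _ _))
    _ = _ := by ring

lemma isWeight_of_laverage_mul_laverage_rpow_ne_top [IsFiniteMeasure μ]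
    (hpq : p.HolderConjugate q) {w : α → ℝ≥0} (hw : AEMeasurable w μ)
    (h0 : ∫⁻ x, w x ∂μ ≠ 0)
    (hA : (⨍⁻ x, w x ∂μ) * (⨍⁻ x, (w x : ℝ≥0∞) ^ (1 - q) ∂μ) ^ (p - 1) ≠ ⊤) :
    IsWeight μ (fun x => w x) ∧ IsWeight μ fun x => (w x : ℝ≥0∞) ^ (1 - q) := by
  have hq : 1 - q < 0 := by linarith [hpq.symm.lt]
  have hσm : AEMeasurable (fun x => (w x : ℝ≥0∞) ^ (1 - q)) μ :=
    hw.coe_nnreal_ennreal.pow_const _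
  have hσ0 (x : α) : (w x : ℝ≥0∞) ^ (1 - q) ≠ 0 := by
    simp [ENNReal.rpow_eq_zero_iff, hpq.symm.lt.le]
  have hw_avg : ⨍⁻ x, w x ∂μ ≠ 0 := fun h => h0 <| by
    rw [← measure_mul_laverage μ, h, mul_zero]
  have hμ : μ ≠ 0 := fun h => h0 (by rw [h, lintegral_zero_measure])
  have hσ_avg : ⨍⁻ x, (w x : ℝ≥0∞) ^ (1 - q) ∂μ ≠ 0 := fun h => by
    have hzero : ∫⁻ x, (w x : ℝ≥0∞) ^ (1 - q) ∂μ = 0 := by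
      rw [← measure_mul_laverage μ, h, mul_zero]
    rw [lintegral_eq_zero_iff' hσm] at hzero
    exact hμ (ae_eq_bot.1 (Filter.eventually_false_iff_eq_bot.1 (hzero.mono fun x => hσ0 x)))
  have hw_top : ⨍⁻ x, w x ∂μ ≠ ⊤ := fun h => hA <| by
    rw [h, ENNReal.top_mul]
    simpa [ENNReal.rpow_eq_zero_iff_of_pos hpq.sub_one_pos] using hσ_avg
  have hσ_top : ⨍⁻ x, (w x : ℝ≥0∞) ^ (1 - q) ∂μ ≠ ⊤ := fun h => hA <| by
    rw [h, ENNReal.top_rpow_of_pos hpq.sub_one_pos, ENNReal.mul_top hw_avg]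
  have hσ_int : ∫⁻ x, (w x : ℝ≥0∞) ^ (1 - q) ∂μ ≠ ⊤ := by
    rw [← measure_mul_laverage μ]
    exact ENNReal.mul_ne_top (measure_ne_top _ _) hσ_top
  refine ⟨⟨hw.coe_nnreal_ennreal, ?_, ?_⟩, hσm, .of_forall hσ0, hσ_int⟩
  · filter_upwards [ae_lt_top' hσm hσ_int] with x hx h
    rw [h, ENNReal.zero_rpow_of_neg hq] at hx
    exact hx.false
  · rw [← measure_mul_laverage μ]
    exact ENNReal.mul_ne_top (measure_ne_top _ _) hw_top

theorem IsLaminar.lintegral_maximalFunction_rpow_mul_le [IsFiniteMeasure μ]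
    (h𝓑 : IsLaminar 𝓑) (hcount : 𝓑.Countable) (hm : ∀ B ∈ 𝓑, MeasurableSet B)
    (htop : ∃ B ∈ 𝓑, ∀ᵐ x ∂μ, x ∈ B) (hpq : p.HolderConjugate q) {w : α → ℝ≥0}
    (hw : AEMeasurable w μ) (hK : K ≠ ⊤)
    (hA : ∀ B ∈ 𝓑,
      (⨍⁻ x in B, w x ∂μ) * (⨍⁻ x in B, (w x : ℝ≥0∞) ^ (1 - q) ∂μ) ^ (p - 1) ≤ K)
    {f : α → ℝ≥0∞} (hf : AEMeasurable f μ) :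
    ∫⁻ x, maximalFunction μ 𝓑 f x ^ p * w x ∂μ ≤
      K ^ q * (ENNReal.ofReal p ^ q * ENNReal.ofReal q ^ p) * ∫⁻ x, f x ^ p * w x ∂μ := by
  rcases eq_or_ne (∫⁻ x, w x ∂μ) 0 with h0 | h0
  · rw [lintegral_eq_zero_iff' hw.coe_nnreal_ennreal] at h0
    refine (lintegral_eq_zero_of_ae_eq_zero (h0.mono fun x hx => ?_)).trans_le zero_le
    simp only [hx, Pi.zero_apply, mul_zero]
  obtain ⟨B, hB, hae⟩ := htop
  have hAB := hA B hB
  rw [Measure.restrict_eq_self_of_ae_mem hae] at hAB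
  obtain ⟨hw, hσ⟩ :=
    isWeight_of_laverage_mul_laverage_rpow_ne_top hpq hw h0 (ne_top_of_le_ne_top hK hAB)
  exact h𝓑.lintegral_maximalFunction_rpow_mul_le_of_isWeight hcount hm hpq hw hσ hA hf

end Weights

section Muckenhoupt

variable {n : ℕ} {Ω : Set (Cn n)} {𝓑 : Set (Set (Cn n))}

lemma avg_eq_setLAverage {B : Set (Cn n)} (hB : B ⊆ Ω) (hm : MeasurableSet B)
    (g : Cn n → ℝ≥0∞) : avg B g = ⨍⁻ z in B, g z ∂volume.restrict Ω := by
  rw [setLAverage_eq, Measure.restrict_restrict_of_subset hB, Measure.restrict_apply hm,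
    inter_eq_self_of_subset_left hB, avg, mul_comm, div_eq_mul_inv]

lemma IsBasis.maximalOp_eq (h𝓑 : IsBasis Ω 𝓑) (f : Cn n → ℂ) :
    maximalOp 𝓑 f = maximalFunction (volume.restrict Ω) 𝓑 fun z => ‖f z‖ₑ :=
  funext fun _ => biSup_congr fun B hB => avg_eq_setLAverage (h𝓑 B hB.1).2.1 (h𝓑 B hB.1).1 _

/-- The constant `K^{p'} p^{p'} (p')^p` of the weighted maximal inequality for laminar families. -/
def muckenhouptConst (p : ℝ) (K : ℝ≥0) : ℝ≥0 :=
  K ^ p.conjExponent * (p.toNNReal ^ p.conjExponent * p.conjExponent.toNNReal ^ p)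

lemma coe_muckenhouptConst {p : ℝ} (hp : 1 < p) (K : ℝ≥0) :
    (muckenhouptConst p K : ℝ≥0∞) = K ^ p.conjExponent *
      (ENNReal.ofReal p ^ p.conjExponent * ENNReal.ofReal p.conjExponent ^ p) := by
  have hpq := Real.HolderConjugate.conjExponent hp
  rw [muckenhouptConst, ENNReal.coe_mul, ENNReal.coe_mul,
    ENNReal.coe_rpow_of_nonneg _ hpq.symm.nonneg, ENNReal.coe_rpow_of_nonneg _ hpq.symm.nonneg,
    ENNReal.coe_rpow_of_nonneg _ hpq.nonneg]
  rfl

theorem isMuckenhouptBasis_of_isLaminar (hΩ : volume Ω ≠ ⊤) (hbasis : IsBasis Ω 𝓑)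
    (hcount : 𝓑.Countable) (hmem : Ω ∈ 𝓑) (hlam : IsLaminar 𝓑) :
    IsMuckenhouptBasis Ω 𝓑 muckenhouptConst := by
  have hm : ∀ B ∈ 𝓑, MeasurableSet B := fun B hB => (hbasis B hB).1
  have : IsFiniteMeasure (volume.restrict Ω) := isFiniteMeasure_restrict.2 hΩ
  refine ⟨hbasis, fun p hp w hw K hA f hf => ?_⟩
  have hpq := Real.HolderConjugate.conjExponent hp
  rw [hbasis.maximalOp_eq, coe_muckenhouptConst hp]
  refine ⟨(measurable_maximalFunction hcount hm _).aemeasurable,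
    hlam.lintegral_maximalFunction_rpow_mul_le hcount hm
      ⟨Ω, hmem, ae_restrict_mem (hm Ω hmem)⟩ hpq hw ENNReal.coe_ne_top (fun B hB => ?_) hf.enorm⟩
  simpa only [avg_eq_setLAverage (hbasis B hB).2.1 (hm B hB)] using hA B hB

lemma maximalOp_iUnion {ι : Type*} (𝓑 : ι → Set (Set (Cn n))) (f : Cn n → ℂ) (z : Cn n) :
    maximalOp (⋃ i, 𝓑 i) f z = ⨆ i, maximalOp (𝓑 i) f z := by
  simp only [maximalOp, mem_iUnion, mem_ofPred_eq, iSup_and, iSup_exists]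
  exact iSup_comm

theorem IsMuckenhouptBasis.iUnion {ι : Type*} [Fintype ι] {𝓑 : ι → Set (Set (Cn n))}
    {C : ι → ℝ → ℝ≥0 → ℝ≥0} (h : ∀ i, IsMuckenhouptBasis Ω (𝓑 i) (C i)) :
    IsMuckenhouptBasis Ω (⋃ i, 𝓑 i) fun p K => ∑ i, C i p K := by
  refine ⟨fun B hB => ?_, fun p hp w hw K hA f hf => ?_⟩
  · obtain ⟨i, hi⟩ := mem_iUnion.1 hB
    exact (h i).1 B hi
  have hi := fun i => (h i).2 p hp w hw K (fun B hB => hA B (mem_iUnion_of_mem i hB)) f hf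
  have hp0 : 0 < p := zero_lt_one.trans hp
  refine ⟨by simpa only [funext (maximalOp_iUnion 𝓑 f)] using .iSup fun i => (hi i).1, ?_⟩
  calc ∫⁻ z in Ω, maximalOp (⋃ i, 𝓑 i) f z ^ p * w z
      ≤ ∫⁻ z in Ω, ∑ i, maximalOp (𝓑 i) f z ^ p * w z := by
        refine lintegral_mono fun z => ?_
        rw [← Finset.sum_mul, maximalOp_iUnion, ← ENNReal.orderIsoRpow_apply p hp0,
          OrderIso.map_iSup]
        gcongr
        exact iSup_le fun i => Finset.single_le_sum (f := fun i => maximalOp (𝓑 i) f z ^ p)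
          (fun _ _ => zero_le) (Finset.mem_univ i)
    _ = ∑ i, ∫⁻ z in Ω, maximalOp (𝓑 i) f z ^ p * w z :=
        lintegral_finsetSum' _ fun i _ => ((hi i).1.pow_const p).mul hw.coe_nnreal_ennreal
    _ ≤ ∑ i, C i p K * ∫⁻ z in Ω, ‖f z‖ₑ ^ p * w z := Finset.sum_le_sum fun i _ => (hi i).2
    _ = _ := by rw [← Finset.sum_mul, ENNReal.ofNNReal_finsetSum]

end Muckenhoupt

section Flow

open Metric Filter Topology Manifold

variable {E F : Type*} [NormedAddCommGroup E] [NormedSpace ℝ E]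
  [NormedAddCommGroup F] [NormedSpace ℝ F]

lemma exists_contDiff_hasCompactSupport_eqOn [FiniteDimensional ℝ E] {m : ℕ∞} {f : E → F}
    {K s : Set E} (hs : IsOpen s) (hf : ContDiffOn ℝ m f s) (hK : IsCompact K) (hKs : K ⊆ s) :
    ∃ g : E → F, ContDiff ℝ m g ∧ HasCompactSupport g ∧ EqOn g f K := by
  obtain ⟨K', hK', hKK', hK's⟩ := exists_compact_between hK hs hKs
  obtain ⟨φ, hφ0, hφ1, -⟩ := exists_contMDiffMap_zero_one_of_isClosed 𝓘(ℝ, E) (n := m)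
    isOpen_interior.isClosed_compl hK.isClosed (disjoint_compl_left_iff_subset.2 hKK')
  have hsupp : tsupport φ ⊆ K' := closure_minimal
    (fun x hx => interior_subset (by_contra fun hx' => hx (hφ0 hx'))) hK'.isClosed
  refine ⟨fun x => φ x • f x, contMDiff_iff_contDiff.1 (contMDiff_of_tsupport fun x hx => ?_),
    (HasCompactSupport.of_support_subset_isCompact hK'
      (subset_closure.trans hsupp)).smul_right, fun x hx => ?_⟩
  · have hxs : x ∈ s := hK's (hsupp (tsupport_smul_subset_left _ _ hx))
    exact (φ.contMDiff.contDiff.contDiffAt.smul (hf.contDiffAt (hs.mem_nhds hxs))).contMDiffAt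
  · simp only [hφ1 hx, Pi.one_apply, one_smul]

lemma exists_integralCurve_continuousOn [CompleteSpace E] {Y : E → E} {K L : ℝ≥0}
    (hK : LipschitzWith K Y) (hL : ∀ z, ‖Y z‖ ≤ L) (R T : ℝ≥0) :
    ∃ Φ : E × ℝ → E, ContinuousOn Φ (closedBall 0 R ×ˢ Icc 0 (T : ℝ)) ∧
      ∀ z ∈ closedBall (0 : E) R, ∀ b ∈ Icc 0 (T : ℝ), ∃ β : ℝ → E,
        IsIntegralCurveOn β (fun _ => Y) (Icc 0 b) ∧ β 0 = Φ (z, b) ∧ β b = z := by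
  have hpl : IsPicardLindelof (fun _ => Y) (⟨0, by simp⟩ : Icc (-T : ℝ) T) 0 (R + L * T) R L K :=
    .of_time_independent (fun x _ => hL x) hK.lipschitzOnWith (by simp)
  obtain ⟨φ, hφ, hφc⟩ := hpl.exists_forall_mem_closedBall_eq_hasDerivWithinAt_continuousOn
  refine ⟨fun q => φ (q.1, -q.2), hφc.comp (by fun_prop) fun q hq => ?_, fun z hz b hb => ?_⟩
  · exact ⟨hq.1, neg_le_neg hq.2.2, (neg_nonpos.2 hq.2.1).trans T.2⟩
  · have hcurve : IsIntegralCurveOn (fun t => φ (z, t)) (fun _ => Y) (Icc (-T : ℝ) T) := (hφ z hz).2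
    refine ⟨fun t => φ (z, t - b), (hcurve.comp_sub b).mono ?_, by simp, by simp [(hφ z hz).1]⟩
    intro t ht
    refine ⟨t - b, ⟨?_, ?_⟩, by simp⟩ <;> linarith [ht.1, ht.2, hb.1, hb.2]

lemma eqOn_Icc_of_isIntegralCurveOn {v : ℝ → E → E} {K : ℝ≥0} (hv : ∀ t, LipschitzWith K (v t))
    {a b : ℝ} {γ β : ℝ → E} (hγ : IsIntegralCurveOn γ v (Icc a b))
    (hβ : IsIntegralCurveOn β v (Icc a b)) (h : γ a = β a ∨ γ b = β b) :
    EqOn γ β (Icc a b) := by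
  have hright {γ : ℝ → E} (hγ : IsIntegralCurveOn γ v (Icc a b)) (t : ℝ) (ht : t ∈ Ico a b) :
      HasDerivWithinAt γ (v t (γ t)) (Ici t) t :=
    (hγ t (Ico_subset_Icc_self ht)).mono_of_mem_nhdsWithin (Icc_mem_nhdsGE_of_mem ht)
  have hleft {γ : ℝ → E} (hγ : IsIntegralCurveOn γ v (Icc a b)) (t : ℝ) (ht : t ∈ Ioc a b) :
      HasDerivWithinAt γ (v t (γ t)) (Iic t) t :=
    (hγ t (Ioc_subset_Icc_self ht)).mono_of_mem_nhdsWithin (Icc_mem_nhdsLE_of_mem ht)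
  rcases h with h | h
  · exact ODE_solution_unique hv hγ.continuousOn (hright hγ) hβ.continuousOn (hright hβ) h
  · exact ODE_solution_unique_of_mem_Icc_left (s := fun _ => univ)
      (fun t _ => (hv t).lipschitzOnWith) hγ.continuousOn (hleft hγ) (fun _ _ => mem_univ _)
      hβ.continuousOn (hleft hβ) (fun _ _ => mem_univ _) h

lemma dist_le_of_isIntegralCurveOn_Icc {v : ℝ → E → E} {L : ℝ≥0} (hv : ∀ t x, ‖v t x‖ ≤ L)
    {a b : ℝ} {β : ℝ → E} (hβ : IsIntegralCurveOn β v (Icc a b)) {t : ℝ} (ht : t ∈ Icc a b) :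
    dist (β t) (β b) ≤ L * (b - a) := by
  have hb : b ∈ Icc a b := right_mem_Icc.2 (ht.1.trans ht.2)
  refine (((convex_Icc a b).lipschitzOnWith_of_nnnorm_hasDerivWithin_le hβ
    fun t _ => hv t (β t)).dist_le_mul t ht b hb).trans ?_
  gcongr
  exact Real.dist_le_of_mem_Icc ht hb

variable {n : ℕ} {r : Cn n → ℝ} {U V : Set (Cn n)} {t₀ : ℝ}

lemma contDiffOn_normalField (hr : ContDiff ℝ 2 r) :
    ContDiffOn ℝ 1 (normalField r) {z | gradient r z ≠ 0} := by
  have hgrad : ContDiff ℝ 1 (gradient r) :=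
    (InnerProductSpace.toDual ℝ (Cn n)).symm.contDiff.comp (hr.fderiv_right (by norm_num))
  exact ((((contDiff_norm_sq ℝ).comp hgrad).contDiffOn.inv fun z hz => by
    simpa using hz).smul hgrad.contDiffOn).neg

lemma continuous_gradient (hr : ContDiff ℝ 1 r) : Continuous (gradient r) :=
  (InnerProductSpace.toDual ℝ (Cn n)).symm.continuous.comp (hr.continuous_fderiv one_ne_zero)

lemma IsFlowNeighborhood.gradient_ne_zero (hU : IsFlowNeighborhood r U V t₀) {z : Cn n}
    (hz : z ∈ U) : gradient r z ≠ 0 :=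
  norm_pos_iff.1 (lt_of_lt_of_le (by norm_num) (hU.gradient_bounds z hz).1)

lemma IsFlowNeighborhood.exists_lipschitzWith_eqOn_normalField
    (hU : IsFlowNeighborhood r U V t₀) (hr : ContDiff ℝ 2 r)
    (hbd : Bornology.IsBounded (domain r)) :
    ∃ (Y : Cn n → Cn n) (K L : ℝ≥0), LipschitzWith K Y ∧ (∀ z, ‖Y z‖ ≤ L) ∧
      EqOn Y (normalField r) (U ∩ thickening 1 (domain r)) := by
  have hgrad : Continuous (gradient r) := continuous_gradient (hr.of_le one_le_two)
  have hcompact : IsCompact (cthickening 1 (domain r) ∩ {z | 2 / 3 ≤ ‖gradient r z‖}) :=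
    (isCompact_of_isClosed_isBounded isClosed_cthickening hbd.cthickening).inter_right
      (isClosed_le continuous_const hgrad.norm)
  obtain ⟨Y, hYd, hYc, hY⟩ := exists_contDiff_hasCompactSupport_eqOn (m := 1)
    (isOpen_ne_fun hgrad continuous_const) (contDiffOn_normalField hr) hcompact fun z hz =>
      norm_pos_iff.1 (lt_of_lt_of_le (by norm_num) hz.2)
  obtain ⟨K, hK⟩ := hYd.lipschitzWith_of_hasCompactSupport hYc one_ne_zero
  obtain ⟨L, hL⟩ := hYd.continuous.bounded_above_of_compact_support hYc
  exact ⟨Y, K, L.toNNReal, hK, fun z => (hL z).trans (Real.le_coe_toNNReal L), fun z hz =>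
    hY ⟨thickening_subset_cthickening _ _ hz.2, (hU.gradient_bounds z hz.1).1⟩⟩

lemma isOpen_domain (hr : Continuous r) : IsOpen (domain r) := isOpen_lt hr continuous_const

lemma apply_eq_zero_of_mem_bdry (hr : Continuous r) {z : Cn n} (hz : z ∈ bdry r) : r z = 0 :=
  frontier_lt_subset_eq hr continuous_const hz

lemma mem_bdry_of_mem_closure_domain (hr : Continuous r) {z : Cn n}
    (hz : z ∈ closure (domain r)) (hz0 : r z = 0) : z ∈ bdry r := by
  rw [bdry, (isOpen_domain hr).frontier_eq]
  exact ⟨hz, fun hlt : r z < 0 => hlt.ne hz0⟩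

lemma apply_eq_sub_of_isIntegralCurveOn (hr : Differentiable ℝ r) {γ : ℝ → Cn n} {b : ℝ}
    (hγ : IsIntegralCurveOn γ (fun _ => normalField r) (Icc 0 b))
    (hne : ∀ t ∈ Icc 0 b, gradient r (γ t) ≠ 0) {t : ℝ} (ht : t ∈ Icc 0 b) :
    r (γ t) = r (γ 0) - t := by
  have hderiv : ∀ t ∈ Icc 0 b, HasDerivWithinAt (fun t => r (γ t) + t) 0 (Icc 0 b) t := by
    intro t ht
    have hcomp := (hr (γ t)).hasGradientAt.hasFDerivAt.comp_hasDerivWithinAt t (hγ t ht)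
    have hnorm : ‖gradient r (γ t)‖ ^ 2 ≠ 0 := pow_ne_zero 2 (norm_ne_zero_iff.2 (hne t ht))
    refine (hcomp.add (hasDerivWithinAt_id t (Icc 0 b))).congr_deriv ?_
    beta_reduce
    rw [InnerProductSpace.toDual_apply_apply, normalField, inner_neg_right, inner_smul_right,
      real_inner_self_eq_norm_sq, inv_mul_cancel₀ hnorm, neg_add_cancel]
  have hconst := constant_of_has_deriv_right_zero (fun t ht => (hderiv t ht).continuousWithinAt)
    (fun t ht => (hderiv t (Ico_subset_Icc_self ht)).mono_of_mem_nhdsWithin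
      (Icc_mem_nhdsGE_of_mem ht)) t ht
  linarith

lemma mem_bdry_of_isIntegralCurveOn (hr : Differentiable ℝ r) {β : ℝ → Cn n} {z : Cn n}
    (hz : z ∈ domain r) (hβ : IsIntegralCurveOn β (fun _ => normalField r) (Icc 0 (-r z)))
    (hne : ∀ t ∈ Icc 0 (-r z), gradient r (β t) ≠ 0) (hβz : β (-r z) = z) : β 0 ∈ bdry r := by
  have hb : 0 < -r z := neg_pos.2 hz
  have hrβ {t : ℝ} (ht : t ∈ Icc 0 (-r z)) := apply_eq_sub_of_isIntegralCurveOn hr hβ hne ht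
  have hr0 : r (β 0) = 0 := by
    have := hrβ (right_mem_Icc.2 hb.le)
    rw [hβz] at this
    linarith
  refine mem_bdry_of_mem_closure_domain hr.continuous ?_ hr0
  have h0 : (0 : ℝ) ∈ closure (Ioc 0 (-r z)) := by
    rw [closure_Ioc hb.ne]
    exact left_mem_Icc.2 hb.le
  refine ((hβ 0 (left_mem_Icc.2 hb.le)).continuousWithinAt.mono Ioc_subset_Icc_self).mem_closure
    h0 fun t ht => ?_
  change r (β t) < 0
  rw [hrβ (Ioc_subset_Icc_self ht), hr0]
  linarith [ht.1]

section FlowLines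

variable {x : Cn n} {b : ℝ} {γ : ℝ → Cn n}

lemma IsFlowLine.isIntegralCurveOn {I : Set ℝ} (hγ : IsFlowLine r U I x γ) :
    IsIntegralCurveOn γ (fun _ => normalField r) I :=
  fun t ht => (hγ.2 t ht).2

lemma IsFlowLine.mono {I J : Set ℝ} (hγ : IsFlowLine r U I x γ) (hJI : J ⊆ I) :
    IsFlowLine r U J x γ :=
  ⟨hγ.1, fun t ht => ⟨(hγ.2 t (hJI ht)).1, (hγ.2 t (hJI ht)).2.mono hJI⟩⟩

lemma IsFlowLine.mem_closure_domain (hU : IsFlowNeighborhood r U V t₀) (hr : Differentiable ℝ r)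
    (hx : x ∈ bdry r) (hγ : IsFlowLine r U (Icc 0 b) x γ) {t : ℝ} (ht : t ∈ Icc 0 b) :
    γ t ∈ closure (domain r) := by
  rcases eq_or_lt_of_le ht.1 with rfl | ht0
  · rw [hγ.1]
    exact frontier_subset_closure hx
  · refine subset_closure (?_ : r (γ t) < 0)
    rw [apply_eq_sub_of_isIntegralCurveOn hr hγ.isIntegralCurveOn
      (fun s hs => hU.gradient_ne_zero (hγ.2 s hs).1) ht, hγ.1,
      apply_eq_zero_of_mem_bdry hr.continuous hx]
    linarith

lemma IsFlowLine.isIntegralCurveOn_of_eqOn {Y : Cn n → Cn n} (hU : IsFlowNeighborhood r U V t₀)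
    (hr : Differentiable ℝ r) (hY : EqOn Y (normalField r) (U ∩ thickening 1 (domain r)))
    (hx : x ∈ bdry r) (hγ : IsFlowLine r U (Icc 0 b) x γ) :
    IsIntegralCurveOn γ (fun _ => Y) (Icc 0 b) := by
  intro t ht
  have hmem := hγ.mem_closure_domain hU hr hx ht
  exact (hγ.2 t ht).2.congr_deriv
    (hY ⟨(hγ.2 t ht).1, closure_subset_thickening one_pos _ hmem⟩).symm

lemma IsFlowNeighborhood.flowsTo_iff {Y : Cn n → Cn n} {K : ℝ≥0}
    (hU : IsFlowNeighborhood r U V t₀) (hr : Differentiable ℝ r) (hK : LipschitzWith K Y)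
    (hY : EqOn Y (normalField r) (U ∩ thickening 1 (domain r))) {z : Cn n}
    (hz : r z ∈ Ioo (-t₀) 0) {β : ℝ → Cn n}
    (hβ : IsIntegralCurveOn β (fun _ => Y) (Icc 0 (-r z))) (hβz : β (-r z) = z) :
    FlowsTo r U x z ↔ x ∈ bdry r ∧ x = β 0 := by
  have hb : 0 ≤ -r z := (neg_pos.2 hz.2).le
  constructor
  · rintro ⟨hx, γ, hγ, hγz⟩
    have heq := eqOn_Icc_of_isIntegralCurveOn (fun _ => hK)
      (hγ.isIntegralCurveOn_of_eqOn hU hr hY hx) hβ (Or.inr (hγz.trans hβz.symm))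
    exact ⟨hx, hγ.1.symm.trans (heq (left_mem_Icc.2 hb))⟩
  · rintro ⟨hx, hxβ⟩
    obtain ⟨γ, hγ⟩ := hU.flow x (hU.bdry_subset hx)
    have hγ' : IsFlowLine r U (Icc 0 (-r z)) x γ := hγ.mono (Icc_subset_Ico_right (neg_lt.1 hz.1))
    have heq := eqOn_Icc_of_isIntegralCurveOn (fun _ => hK)
      (hγ'.isIntegralCurveOn_of_eqOn hU hr hY hx) hβ (Or.inl (hγ.1.trans hxβ))
    exact ⟨hx, γ, hγ', (heq (right_mem_Icc.2 hb)).trans hβz⟩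

end FlowLines

/-- `Ψ` extends `Π^flow` continuously to the whole shell `{-t₀ < r < 0}`, of which some points may
not lie on a flow line from `bΩ` in `U`, and it has the boundary values of `Π^flow`. -/
structure IsFlowProjExtension (r : Cn n → ℝ) (U : Set (Cn n)) (t₀ : ℝ) (Ψ : Cn n → Cn n) :
    Prop where
  continuousOn : ContinuousOn Ψ {z | r z ∈ Ioo (-t₀) 0}
  flowsTo_iff : ∀ z, r z ∈ Ioo (-t₀) 0 → ∀ x, FlowsTo r U x z ↔ x ∈ bdry r ∧ x = Ψ z
  tendsto : ∀ c ∈ bdry r, Tendsto Ψ (𝓝[domain r] c) (𝓝[bdry r] c)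

lemma IsFlowNeighborhood.tendsto_nhdsWithin_bdry {Y Ψ : Cn n → Cn n} {L : ℝ≥0}
    (hU : IsFlowNeighborhood r U V t₀) (hr : Differentiable ℝ r) (hL : ∀ z, ‖Y z‖ ≤ L)
    (hY : EqOn Y (normalField r) (U ∩ thickening 1 (domain r)))
    (hΨ : ∀ z, r z ∈ Ioo (-t₀) 0 → ∃ β : ℝ → Cn n,
      IsIntegralCurveOn β (fun _ => Y) (Icc 0 (-r z)) ∧ β 0 = Ψ z ∧ β (-r z) = z)
    {c : Cn n} (hc : c ∈ bdry r) : Tendsto Ψ (𝓝[domain r] c) (𝓝[bdry r] c) := by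
  set g : Cn n → ℝ := fun z => L * -r z + dist z c with hg
  have hrc : r c = 0 := apply_eq_zero_of_mem_bdry hr.continuous hc
  have hg0 : Tendsto g (𝓝[domain r] c) (𝓝 0) := by
    have hgc : g c = 0 := by simp [hg, hrc]
    have := hr.continuous
    exact hgc ▸ (by fun_prop : Continuous g).continuousWithinAt
  have hshell : ∀ᶠ z in 𝓝[domain r] c, r z ∈ Ioo (-t₀) 0 := by
    have : ∀ᶠ z in 𝓝[domain r] c, -t₀ < r z := nhdsWithin_le_nhds <|
      hr.continuous.tendsto c |>.eventually_const_lt (by linarith [hU.t₀_pos])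
    filter_upwards [this, self_mem_nhdsWithin] with z hz hz' using ⟨hz, hz'⟩
  have hdist {β : ℝ → Cn n} {z : Cn n} (hβz : β (-r z) = z)
      (hβ : IsIntegralCurveOn β (fun _ => Y) (Icc 0 (-r z))) {t : ℝ} (ht : t ∈ Icc 0 (-r z)) :
      dist (β t) c ≤ g z := by
    have hβt := dist_le_of_isIntegralCurveOn_Icc (fun _ => hL) hβ ht
    rw [hβz, sub_zero] at hβt
    linarith [dist_triangle (β t) z c]
  obtain ⟨ρ, hρ, hball⟩ := Metric.isOpen_iff.1 (hU.isOpen_U.inter isOpen_thickening) c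
    ⟨hU.subset (hU.bdry_subset hc),
      closure_subset_thickening one_pos (domain r) (frontier_subset_closure hc)⟩
  refine tendsto_nhdsWithin_iff.2 ⟨tendsto_iff_dist_tendsto_zero.2 ?_, ?_⟩
  · refine squeeze_zero' (.of_forall fun _ => dist_nonneg) ?_ hg0
    filter_upwards [hshell] with z hz
    obtain ⟨β, hβ, hβ0, hβz⟩ := hΨ z hz
    exact hβ0 ▸ hdist hβz hβ (left_mem_Icc.2 (neg_pos.2 hz.2).le)
  · filter_upwards [hshell, hg0.eventually_lt_const hρ] with z hz hgz
    obtain ⟨β, hβ, hβ0, hβz⟩ := hΨ z hz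
    have hmem : ∀ t ∈ Icc 0 (-r z), β t ∈ U ∩ thickening 1 (domain r) := fun t ht =>
      hball ((hdist hβz hβ ht).trans_lt hgz)
    exact hβ0 ▸ mem_bdry_of_isIntegralCurveOn hr hz.2
      (fun t ht => (hβ t ht).congr_deriv (hY (hmem t ht)))
      (fun t ht => hU.gradient_ne_zero (hmem t ht).1) hβz

theorem IsFlowNeighborhood.exists_isFlowProjExtension (hU : IsFlowNeighborhood r U V t₀)
    (hr : ContDiff ℝ 2 r) (hbd : Bornology.IsBounded (domain r)) :
    ∃ Ψ, IsFlowProjExtension r U t₀ Ψ := by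
  have hdiff : Differentiable ℝ r := hr.differentiable two_ne_zero
  obtain ⟨Y, K, L, hK, hL, hY⟩ := hU.exists_lipschitzWith_eqOn_normalField hr hbd
  obtain ⟨R, hR⟩ := hbd.subset_closedBall (0 : Cn n)
  obtain ⟨Φ, hΦ, hcurve⟩ := exists_integralCurve_continuousOn hK hL R.toNNReal t₀.toNNReal
  have hmem {z : Cn n} (hz : r z ∈ Ioo (-t₀) 0) :
      z ∈ closedBall (0 : Cn n) R.toNNReal ∧ -r z ∈ Icc 0 (t₀.toNNReal : ℝ) :=
    ⟨closedBall_subset_closedBall (Real.le_coe_toNNReal R) (hR hz.2), (neg_pos.2 hz.2).le,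
      (neg_lt.1 hz.1).le.trans (Real.le_coe_toNNReal t₀)⟩
  have hΨ (z : Cn n) (hz : r z ∈ Ioo (-t₀) 0) := hcurve z (hmem hz).1 (-r z) (hmem hz).2
  refine ⟨fun z => Φ (z, -r z), ?_, fun z hz x => ?_, fun c hc => ?_⟩
  · exact hΦ.comp (continuous_id.prodMk hr.continuous.neg).continuousOn fun z hz => hmem hz
  · obtain ⟨β, hβ, hβ0, hβz⟩ := hΨ z hz
    exact hβ0 ▸ hU.flowsTo_iff hdiff hK hY hz hβ hβz
  · exact hU.tendsto_nhdsWithin_bdry hdiff hL hY hΨ hc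

end Flow

section Tents

open Metric Filter Topology

lemma measurableSet_inter_preimage_of_continuousOn {X Y : Type*} [TopologicalSpace X]
    [MeasurableSpace X] [OpensMeasurableSpace X] [TopologicalSpace Y] [MeasurableSpace Y]
    [BorelSpace Y] {f : X → Y} {s : Set X} {t : Set Y} (hf : ContinuousOn f s)
    (hs : MeasurableSet s) (ht : MeasurableSet t) : MeasurableSet (s ∩ f ⁻¹' t) := by
  have hpre := hs.subtype_image ((continuousOn_iff_continuous_domRestrict.1 hf).measurable ht)
  rwa [domRestrict_eq, preimage_comp, Subtype.image_preimage_coe] at hpre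

lemma measure_pos_of_mem_nhdsWithin_of_mem_closure {X : Type*} [TopologicalSpace X]
    [MeasurableSpace X] (μ : Measure X) [μ.IsOpenPosMeasure] {s t : Set X} {x : X}
    (hs : IsOpen s) (hx : x ∈ closure s) (ht : t ∈ 𝓝[s] x) : 0 < μ t := by
  obtain ⟨u, hu, hxu, hut⟩ := mem_nhdsWithin.1 ht
  exact ((hu.inter hs).measure_pos μ (mem_closure_iff.1 hx u hu hxu)).trans_le (measure_mono hut)

lemma countable_of_pairwiseDisjoint_of_measure_pos {X : Type*} [MeasurableSpace X]
    (μ : Measure X) [SFinite μ] {𝓑 : Set (Set X)} (hm : ∀ B ∈ 𝓑, MeasurableSet B)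
    (hpos : ∀ B ∈ 𝓑, 0 < μ B) (hdisj : 𝓑.PairwiseDisjoint id) : 𝓑.Countable := by
  have hcount := Measure.countable_meas_pos_of_disjoint_iUnion (μ := μ)
    (fun B : 𝓑 => hm B B.2) ((pairwise_subtype_iff_pairwise_set _ _).2 hdisj)
  have huniv : {B : 𝓑 | 0 < μ B} = univ := eq_univ_of_forall fun B => hpos B B.2
  rwa [huniv, countable_univ_iff] at hcount

variable {n : ℕ} {r : Cn n → ℝ} {e : BasisChoice n} {U V : Set (Cn n)} {t₀ : ℝ}

lemma le_tau {ξ u : Cn n} {ε s : ℝ} (hs : 0 ≤ s)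
    (h : ∀ l : ℂ, ‖l‖ ≤ s → |r (ξ + l • u) - r ξ| ≤ ε) : ENNReal.ofReal s ≤ tau r ξ u ε :=
  le_iSup₂_of_le s.toNNReal (fun l hl => h l (by rwa [Real.coe_toNNReal _ hs] at hl)) le_rfl

lemma mem_polydisc {ξ z : Cn n} {ε s : ℝ} (hz : dist z ξ ≤ s)
    (h : ∀ y, dist y ξ ≤ s → |r y - r ξ| ≤ ε) : z ∈ polydisc r e ξ ε := by
  intro k
  have hτ : ENNReal.ofReal s ≤ tau r ξ (e ξ ε k) ε := le_tau (dist_nonneg.trans hz) fun l hl =>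
    h _ (by rwa [dist_self_add_left, norm_smul, (e ξ ε).norm_eq_one, mul_one])
  have hcoord : ‖(e ξ ε).repr (z - ξ) k‖ ≤ s := by
    refine (PiLp.norm_apply_le _ k).trans ?_
    rwa [LinearIsometryEquiv.norm_map, ← dist_eq_norm]
  exact (ofReal_norm _).symm.le.trans ((ENNReal.ofReal_le_ofReal hcoord).trans hτ)

lemma rho_le {ζ η : Cn n} {ε : ℝ} (hε : 0 < ε) (hζ : ζ ∈ polydisc r e η ε)
    (hη : η ∈ polydisc r e ζ ε) : rho r e ζ η ≤ ε :=
  csInf_le ⟨0, fun _ hx => hx.1.le⟩ ⟨hε, hζ, hη⟩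

lemma qball_mem_nhdsWithin (hr : Continuous r) (e : BasisChoice n) (c : Cn n) {ε : ℝ}
    (hε : 0 < ε) : qball r e c ε ∈ 𝓝[bdry r] c := by
  obtain ⟨d, hd, hball⟩ := Metric.continuousAt_iff.1 hr.continuousAt (ε / 4) (by positivity)
  have hosc : ∀ ξ, dist ξ c < d / 2 → ∀ y, dist y ξ ≤ d / 4 → |r y - r ξ| ≤ ε / 2 := by
    intro ξ hξ y hy
    have hyc := hball (x := y) (by linarith [dist_triangle y ξ c])
    have hξc := hball (x := ξ) (by linarith)
    rw [← Real.dist_eq]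
    linarith [dist_triangle_right (r y) (r ξ) (r c)]
  refine mem_of_superset (inter_mem self_mem_nhdsWithin
    (mem_nhdsWithin_of_mem_nhds (ball_mem_nhds c (by positivity : 0 < d / 4)))) ?_
  rintro η ⟨hη, hηc⟩
  rw [mem_ball] at hηc
  refine ⟨hη, (rho_le (half_pos hε) ?_ ?_).trans_lt (half_lt_self hε)⟩
  · exact mem_polydisc hηc.le (hosc c (by rw [dist_self]; positivity))
  · exact mem_polydisc (by rw [dist_comm]; exact hηc.le) (hosc η (by linarith))

namespace DyadicGrid

variable (D : DyadicGrid r e) {k l : ℕ} {P Q : Set (Cn n)}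

lemma subset_bdry (hk : 1 ≤ k) (hQ : Q ∈ D.cubes k) : Q ⊆ bdry r := by
  rw [← D.cover k hk]
  exact subset_sUnion_of_mem hQ

lemma eq_of_subset (hk : 1 ≤ k) (hP : P ∈ D.cubes k) (hQ : Q ∈ D.cubes k) (h : P ⊆ Q) :
    P = Q := by
  obtain ⟨P', hP', hsub⟩ := D.exists_child k hk P hP
  exact (D.exists_unique_parent k hk P' hP').unique ⟨hP, hsub⟩ ⟨hQ, hsub.trans h⟩

lemma eq_of_inter_nonempty (hk : 1 ≤ k) (hP : P ∈ D.cubes k) (hQ : Q ∈ D.cubes k)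
    (h : (P ∩ Q).Nonempty) : P = Q := by
  rcases D.nested k k hk hk P hP Q hQ h with h | h
  · exact D.eq_of_subset hk hP hQ h
  · exact (D.eq_of_subset hk hQ hP h).symm

lemma exists_ancestor (hk : 1 ≤ k) (hkl : k ≤ l) (hQ : Q ∈ D.cubes l) :
    ∃ P ∈ D.cubes k, Q ⊆ P := by
  induction l, hkl using Nat.le_induction generalizing Q with
  | base => exact ⟨Q, hQ, subset_rfl⟩
  | succ l hkl ih =>
    obtain ⟨P, ⟨hP, hQP⟩, -⟩ := D.exists_unique_parent l (hk.trans hkl) Q hQ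
    obtain ⟨P', hP', hPP'⟩ := ih hP
    exact ⟨P', hP', hQP.trans hPP'⟩

lemma subset_of_inter_nonempty (hk : 1 ≤ k) (hkl : k ≤ l) (hP : P ∈ D.cubes k)
    (hQ : Q ∈ D.cubes l) (h : (P ∩ Q).Nonempty) : Q ⊆ P := by
  obtain ⟨P', hP', hQP'⟩ := D.exists_ancestor hk hkl hQ
  rwa [D.eq_of_inter_nonempty hk hP hP' (h.mono (inter_subset_inter_right _ hQP'))]

lemma pow_δ_le (hkl : k ≤ l) : D.δ ^ l ≤ D.δ ^ k :=
  pow_le_pow_of_le_one D.δ_pos.le D.δ_lt_one.le hkl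

lemma mem_nhdsWithin_center (hr : Continuous r) (hk : 1 ≤ k) (hQ : Q ∈ D.cubes k) :
    Q ∈ 𝓝[bdry r] D.center k Q :=
  mem_of_superset (qball_mem_nhdsWithin hr e _ (pow_pos D.δ_pos k)) (D.sandwich k hk Q hQ).1

end DyadicGrid

section FlowTent

variable {Ψ : Cn n → Cn n} {Q : Set (Cn n)} {l : ℝ}

lemma flowTent_subset_domain (Q : Set (Cn n)) (l : ℝ) : flowTent r U V Q l ⊆ domain r :=
  fun _ hz => hz.2.2.2

lemma flowTent_mono {P : Set (Cn n)} {m : ℝ} (h : P ⊆ Q) (hml : m ≤ l) :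
    flowTent r U V P m ⊆ flowTent r U V Q l :=
  fun _ hz => ⟨hz.1, h hz.2.1, Ioo_subset_Ioo_left (neg_le_neg hml) hz.2.2⟩

lemma IsFlowProjExtension.flowProj_mem_iff (hΨ : IsFlowProjExtension r U t₀ Ψ)
    (hr : Continuous r) (hQ : Q ⊆ bdry r) {z : Cn n} (hz : r z ∈ Ioo (-t₀) 0) :
    flowProj r U z ∈ Q ↔ Ψ z ∈ Q := by
  by_cases hex : ∃ x, FlowsTo r U x z
  · rw [flowProj, dif_pos hex, ((hΨ.flowsTo_iff z hz _).1 hex.choose_spec).2]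
  · have hzQ : z ∉ Q := fun hzQ => hz.2.ne (apply_eq_zero_of_mem_bdry hr (hQ hzQ))
    have hΨQ : Ψ z ∉ Q := fun hΨQ => hex ⟨_, (hΨ.flowsTo_iff z hz _).2 ⟨hQ hΨQ, rfl⟩⟩
    rw [flowProj, dif_neg hex, iff_false_left hzQ]
    exact hΨQ

lemma IsFlowProjExtension.flowTent_eq (hΨ : IsFlowProjExtension r U t₀ Ψ) (hr : Continuous r)
    (hQ : Q ⊆ bdry r) (hl : l ≤ t₀) :
    flowTent r U V Q l = V ∩ ({z | r z ∈ Ioo (-l) 0} ∩ Ψ ⁻¹' Q) := by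
  ext z
  refine and_congr_right fun _ => and_comm.trans (and_congr_right fun hz => ?_)
  exact hΨ.flowProj_mem_iff hr hQ (Ioo_subset_Ioo_left (neg_le_neg hl) hz)

lemma IsFlowProjExtension.measurableSet_flowTent (hΨ : IsFlowProjExtension r U t₀ Ψ)
    (hU : IsFlowNeighborhood r U V t₀) (hr : Continuous r) (hQ : Q ⊆ bdry r)
    (hQm : MeasurableSet Q) (hl : l ≤ t₀) : MeasurableSet (flowTent r U V Q l) := by
  rw [hΨ.flowTent_eq hr hQ hl]
  refine hU.isOpen_V.measurableSet.inter (measurableSet_inter_preimage_of_continuousOn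
    (hΨ.continuousOn.mono fun z hz => ?_) (hr.measurable measurableSet_Ioo) hQm)
  exact Ioo_subset_Ioo_left (neg_le_neg hl) hz

lemma IsFlowProjExtension.flowTent_mem_nhdsWithin (hΨ : IsFlowProjExtension r U t₀ Ψ)
    (hU : IsFlowNeighborhood r U V t₀) (hr : Continuous r) (hQ : Q ⊆ bdry r) (hl : 0 < l)
    (hlt : l ≤ t₀) {c : Cn n} (hc : c ∈ bdry r) (hQc : Q ∈ 𝓝[bdry r] c) :
    flowTent r U V Q l ∈ 𝓝[domain r] c := by
  have hV : ∀ᶠ z in 𝓝[domain r] c, z ∈ V :=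
    mem_nhdsWithin_of_mem_nhds (hU.isOpen_V.mem_nhds (hU.bdry_subset hc))
  have hrc : -l < r c := by
    rw [apply_eq_zero_of_mem_bdry hr hc]
    exact neg_neg_of_pos hl
  have hlt' : ∀ᶠ z in 𝓝[domain r] c, -l < r z :=
    nhdsWithin_le_nhds ((hr.tendsto c).eventually_const_lt hrc)
  rw [hΨ.flowTent_eq hr hQ hlt]
  filter_upwards [hV, hlt', self_mem_nhdsWithin, hΨ.tendsto c hc hQc] with z hzV hzl hz0 hzQ
    using ⟨hzV, ⟨hzl, hz0⟩, hzQ⟩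

end FlowTent

lemma isBasis_tents (hU : IsFlowNeighborhood r U V t₀) (hr : ContDiff ℝ 2 r)
    (hne : (domain r).Nonempty) (hbd : Bornology.IsBounded (domain r)) (D : DyadicGrid r e) {N₀ : ℕ}
    (hN : IsAdmissible r V t₀ D.δ N₀) : IsBasis (domain r) (tents r U V D N₀) := by
  have hopen : IsOpen (domain r) := isOpen_domain hr.continuous
  obtain ⟨Ψ, hΨ⟩ := hU.exists_isFlowProjExtension hr hbd
  rintro B (rfl | ⟨k, hk, Q, hQ, rfl⟩)
  · exact ⟨hopen.measurableSet, subset_rfl, hopen.measure_pos volume hne⟩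
  · have hk1 : 1 ≤ k := hN.1.trans hk
    have hQb := D.subset_bdry hk1 hQ
    have hδ : D.δ ^ k ≤ t₀ := (D.pow_δ_le hk).trans hN.2.1.le
    have hc := D.center_mem k hk1 Q hQ
    exact ⟨hΨ.measurableSet_flowTent hU hr.continuous hQb (D.measurable k hk1 Q hQ) hδ,
      flowTent_subset_domain Q _,
      measure_pos_of_mem_nhdsWithin_of_mem_closure volume hopen (frontier_subset_closure hc)
        (hΨ.flowTent_mem_nhdsWithin hU hr.continuous hQb (pow_pos D.δ_pos k) hδ hc
          (D.mem_nhdsWithin_center hr.continuous hk1 hQ))⟩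

lemma flowTent_subset_of_inter_nonempty (D : DyadicGrid r e) {k l : ℕ} (hk : 1 ≤ k) (hkl : k ≤ l)
    {P Q : Set (Cn n)} (hP : P ∈ D.cubes k) (hQ : Q ∈ D.cubes l)
    (h : (flowTent r U V P (D.δ ^ k) ∩ flowTent r U V Q (D.δ ^ l)).Nonempty) :
    flowTent r U V Q (D.δ ^ l) ⊆ flowTent r U V P (D.δ ^ k) := by
  obtain ⟨z, hzP, hzQ⟩ := h
  exact flowTent_mono (D.subset_of_inter_nonempty hk hkl hP hQ ⟨_, hzP.2.1, hzQ.2.1⟩)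
    (D.pow_δ_le hkl)

lemma isLaminar_tents (D : DyadicGrid r e) {N₀ : ℕ} (hN : 1 ≤ N₀) :
    IsLaminar (tents r U V D N₀) := by
  rintro A (rfl | ⟨k, hk, P, hP, rfl⟩) B (rfl | ⟨l, hl, Q, hQ, rfl⟩) hne
  · exact Or.inl subset_rfl
  · exact Or.inr (flowTent_subset_domain Q _)
  · exact Or.inl (flowTent_subset_domain P _)
  · rcases le_total k l with hkl | hkl
    · exact Or.inr (flowTent_subset_of_inter_nonempty D (hN.trans hk) hkl hP hQ hne)
    · exact Or.inl (flowTent_subset_of_inter_nonempty D (hN.trans hl) hkl hQ hP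
        (inter_comm _ _ ▸ hne))

lemma countable_tents (D : DyadicGrid r e) {N₀ : ℕ} (hN : 1 ≤ N₀)
    (h : IsBasis (domain r) (tents r U V D N₀)) : (tents r U V D N₀).Countable := by
  have hgen : ∀ k ∈ Ici N₀, ((fun Q => flowTent r U V Q (D.δ ^ k)) '' D.cubes k).Countable := by
    intro k hk
    have hsub : (fun Q => flowTent r U V Q (D.δ ^ k)) '' D.cubes k ⊆ tents r U V D N₀ := by
      rintro _ ⟨Q, hQ, rfl⟩
      exact Or.inr ⟨k, hk, Q, hQ, rfl⟩
    refine countable_of_pairwiseDisjoint_of_measure_pos volume (fun B hB => (h B (hsub hB)).1)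
      (fun B hB => (h B (hsub hB)).2.2) ?_
    rintro _ ⟨P, hP, rfl⟩ _ ⟨Q, hQ, rfl⟩ hPQ
    refine disjoint_left.2 fun z hzP hzQ => hPQ ?_
    rw [D.eq_of_inter_nonempty (hN.trans hk) hP hQ ⟨_, hzP.2.1, hzQ.2.1⟩]
  refine ((countable_singleton _).union ((to_countable _).biUnion hgen)).mono
    (union_subset_union_right _ ?_)
  rintro _ ⟨k, hk, Q, hQ, rfl⟩
  exact mem_biUnion hk (mem_image_of_mem _ hQ)

theorem isMuckenhouptBasis_tents (hU : IsFlowNeighborhood r U V t₀) (hr : ContDiff ℝ 2 r)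
    (hne : (domain r).Nonempty) (hbd : Bornology.IsBounded (domain r)) (D : DyadicGrid r e) {N₀ : ℕ}
    (hN : IsAdmissible r V t₀ D.δ N₀) :
    IsMuckenhouptBasis (domain r) (tents r U V D N₀) muckenhouptConst := by
  have hbasis : IsBasis (domain r) (tents r U V D N₀) := isBasis_tents hU hr hne hbd D hN
  exact isMuckenhouptBasis_of_isLaminar hbd.measure_lt_top.ne hbasis
    (countable_tents D hN.1 hbasis) (Or.inl rfl) (isLaminar_tents D hN.1)

end Tents

end FlowTents

end

theorem proposition3p7_general {n : ℕ} {r : FlowTents.Cn n → ℝ} (hr : ContDiff ℝ 2 r)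
    (hne : (FlowTents.domain r).Nonempty) (hbd : Bornology.IsBounded (FlowTents.domain r))
    {U V : Set (FlowTents.Cn n)} {t₀ : ℝ} (hU : FlowTents.IsFlowNeighborhood r U V t₀)
    {e : FlowTents.BasisChoice n} :
    (∀ (D : FlowTents.DyadicGrid r e) (N₀ : ℕ), FlowTents.IsAdmissible r V t₀ D.δ N₀ →
      FlowTents.IsMuckenhouptBasis (FlowTents.domain r) (FlowTents.tents r U V D N₀)
        FlowTents.muckenhouptConst) ∧
    (∀ (K₀ : ℕ) (D : Fin K₀ → FlowTents.DyadicGrid r e) (N₀ : Fin K₀ → ℕ),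
      (∀ i, FlowTents.IsAdmissible r V t₀ (D i).δ (N₀ i)) →
      FlowTents.IsMuckenhouptBasis (FlowTents.domain r)
        (⋃ i, FlowTents.tents r U V (D i) (N₀ i))
        fun p K => K₀ * FlowTents.muckenhouptConst p K) := by
  have htents (D : FlowTents.DyadicGrid r e) {N₀ : ℕ}
      (hN : FlowTents.IsAdmissible r V t₀ D.δ N₀) :=
    FlowTents.isMuckenhouptBasis_tents hU hr hne hbd D hN
  refine ⟨fun D _ hN => htents D hN, fun K₀ D _ hN => ?_⟩
  simpa only [Finset.sum_const, Finset.card_univ, Fintype.card_fin, nsmul_eq_mul] using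
    FlowTents.IsMuckenhouptBasis.iUnion fun i => htents (D i) (hN i)

theorem proposition3p7 (n : ℕ) (hn : 1 < n) (r : FlowTents.Cn n → ℝ) (M : ℕ)
    (hr : FlowTents.IsDefiningFunction r M) :
    (∃ C : ℝ → ℝ≥0 → ℝ≥0,
      ∀ (U V : Set (FlowTents.Cn n)) (t₀ : ℝ), FlowTents.IsFlowNeighborhood r U V t₀ →
      ∀ e : FlowTents.BasisChoice n, FlowTents.IsExtremalChoice r e →
      ∀ (D : FlowTents.DyadicGrid r e) (N₀ : ℕ), FlowTents.IsAdmissible r V t₀ D.δ N₀ →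
        FlowTents.IsMuckenhouptBasis (FlowTents.domain r) (FlowTents.tents r U V D N₀) C) ∧
    (∀ K₀ : ℕ, ∃ C : ℝ → ℝ≥0 → ℝ≥0,
      ∀ (U V : Set (FlowTents.Cn n)) (t₀ : ℝ), FlowTents.IsFlowNeighborhood r U V t₀ →
      ∀ e : FlowTents.BasisChoice n, FlowTents.IsExtremalChoice r e →
      ∀ (D : Fin K₀ → FlowTents.DyadicGrid r e) (N₀ : Fin K₀ → ℕ),
        (∀ i, FlowTents.IsAdmissible r V t₀ (D i).δ (N₀ i)) →
        FlowTents.IsMuckenhouptBasis (FlowTents.domain r)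
          (⋃ i, FlowTents.tents r U V (D i) (N₀ i)) C) := by
  have hgeneral {U V t₀} (hU : FlowTents.IsFlowNeighborhood r U V t₀) (e) :=
    proposition3p7_general (hr.smooth.of_le (by norm_cast)) hr.nonempty hr.bounded hU (e := e)
  exact ⟨⟨_, fun _ _ _ hU e _ => (hgeneral hU e).1⟩,
    fun K₀ => ⟨_, fun _ _ _ hU e _ => (hgeneral hU e).2 K₀⟩⟩
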